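/- Let $U$ be a unitary operator on $\mathbb C^{d_A}\otimes\mathbb C^{d_B}$ (a bipartite gate, with Alice acting on the first factor and Bob on the second). A protocol with $n$ uses of $U$ is a sequence of operations consisting of exactly $n$ applications of $U$, the prescribed numbers of consumed cobits, and arbitrary local isometries of Alice and of Bob (on registers of arbitrary finite dimension), in any order, with nothing measured. A cobit from Alice to Bob is the isometry $|x\rangle^A\mapsto|x\rangle^A|x\rangle^B$ ($x\in\{0,1\}$), a cobit from Bob to Alice is the isometry $|x\rangle^B\mapsto|x\rangle^A|x\rangle^B$, and an ebit is the state $|\Phi\rangle^{AB}=\frac1{\sqrt2}\sum_{x=0}^1|x\rangle^A|x\rangle^B$. For $(C_1,C_2,E)\in\mathbb R^3$ write $r^+=\max(r,0)$ and $r^-=\max(-r,0)$. The clean coherent capacity region $\mathrm{clCCE}(U)$ is the set of all $(C_1,C_2,E)\in\mathbb R^3$ such that for every $\varepsilon>0$ and all sufficiently large $n$ there are natural numbers $p,q,b,f,g,a,k,l$ and a protocol ${\cal P}_n$ with $n$ uses of $U$ that consumes $f$ cobits from Alice to Bob, $g$ cobits from Bob to Alice and $a$ ebits, such that * $p,q,b$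 are within $\varepsilon n$ of $nC_1^+,\ nC_2^+,\ nE^+$ (resources produced), and $f,g,a$ are within $\varepsilon n$ of $nC_1^-,\ nC_2^-,\ nE^-$ (resources consumed); * the isometry $|x\rangle^A|y\rangle^B\mapsto{\cal P}_n\big(|x\rangle^A|y\rangle^B|\Phi\rangle^{\otimes a}\big)$, $x\in\{0,1\}^p$, $y\in\{0,1\}^q$, is within $\varepsilon$ in operator norm of the isometry $$|x\rangle^A|y\rangle^B\mapsto|x,y\rangle^A\,|x,y\rangle^B\,|\Phi\rangle^{\otimes b}\,(|0\rangle^{A})^{\otimes k}(|0\rangle^{B})^{\otimes l};$$ * $k\le n\,(-E-C_2)^+ +\varepsilon n$ and $l\le n\,(-E-C_1)^+ +\varepsilon n$. (Thus, beyond the qubits that a party necessarily has left over because it holds more qubits of consumed than of produced resources, at most $\varepsilon n$ qubits per party are discarded, all in the state $|0\rangle$; for $C_1,C_2,E\ge0$ the bounds are just $k,l\le\varepsilon n$.) **Theorem.** For every bipartite unitary $U$ and all real $C_1,C_2,E$, $$(C_1,C_2,E)\in\mathrm{clCCE}(U)\iff(C_2,C_1,-E-C_1-C_2)\in\mathrm{clCCE}(U^\dagger).$$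 So the clean capacity region of the inverse gate is completely determined by that of $U$. -/

import Mathlib

open Filter
open scoped Matrix Kronecker

namespace CleanGate

/-- Strings of `k` bits, indexing the computational basis of `k` qubits. -/
abbrev Bits (k : ℕ) : Type := Fin k → Bool

/-- `V` is (the matrix of) an isometry `ℂ^α → ℂ^γ`. -/
def IsIsometry {α γ : Type} [Fintype γ] [DecidableEq α] (V : Matrix γ α ℂ) : Prop :=
  Vᴴ * V = 1

/-- One use of the bipartite gate `U` when Alice holds the gate's first input together with a
further register `α`, and Bob holds the gate's second input together with a further register `β`:
the operator `U ⊗ 1`, with the tensor factors grouped as (Alice) × (Bob). -/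
def gateOp {dA dB : ℕ} (U : Matrix (Fin dA × Fin dB) (Fin dA × Fin dB) ℂ)
    (α β : Type) [DecidableEq α] [DecidableEq β] :
    Matrix ((Fin dA × α) × (Fin dB × β)) ((Fin dA × α) × (Fin dB × β)) ℂ :=
  Matrix.of fun r s =>
    if r.1.2 = s.1.2 ∧ r.2.2 = s.2.2 then U (r.1.1, r.2.1) (s.1.1, s.2.1) else 0

/-- One cobit from Alice to Bob: the isometry `|x⟩ ↦ |x⟩|x⟩` from a qubit of Alice's to a qubit of
Alice's and a qubit of Bob's, acting as the identity on the other registers `α` and `β`. -/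
def cobitAB (α β : Type) [DecidableEq α] [DecidableEq β] :
    Matrix ((Bool × α) × (Bool × β)) ((Bool × α) × β) ℂ :=
  Matrix.of fun r s => if r.1 = s.1 ∧ r.2 = (s.1.1, s.2) then 1 else 0

/-- One cobit from Bob to Alice. -/
def cobitBA (α β : Type) [DecidableEq α] [DecidableEq β] :
    Matrix ((Bool × α) × (Bool × β)) (α × (Bool × β)) ℂ :=
  Matrix.of fun r s => if r.1 = (s.2.1, s.1) ∧ r.2 = s.2 then 1 else 0

/-- `Protocol U n f g α β γ δ P`: the operator `P`, from Alice's register `α` and Bob's register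
`β` to Alice's register `γ` and Bob's register `δ`, is carried out by a sequence of operations
consisting of exactly `n` uses of the gate `U`, exactly `f` cobits from Alice to Bob and exactly `g`
cobits from Bob to Alice, in any order and interleaved with arbitrary local isometries (which may
enlarge the registers).  Nothing is measured or discarded.  For `f = g = 0` these are the operators
`(A_n ⊗ B_n) U ⋯ U (A_1 ⊗ B_1) U (A_0 ⊗ B_0)`. -/
inductive Protocol {dA dB : ℕ} (U : Matrix (Fin dA × Fin dB) (Fin dA × Fin dB) ℂ) :
    ℕ → ℕ → ℕ → ∀ α β γ δ : Type, Matrix (γ × δ) (α × β) ℂ → Prop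
  | localOps {α β γ δ : Type} [Fintype α] [DecidableEq α] [Fintype β] [DecidableEq β]
      [Fintype γ] [Fintype δ] (V : Matrix γ α ℂ) (W : Matrix δ β ℂ)
      (hV : IsIsometry V) (hW : IsIsometry W) :
      Protocol U 0 0 0 α β γ δ (V ⊗ₖ W)
  | gate (α β : Type) [Fintype α] [DecidableEq α] [Fintype β] [DecidableEq β] :
      Protocol U 1 0 0 (Fin dA × α) (Fin dB × β) (Fin dA × α) (Fin dB × β) (gateOp U α β)
  | sendAB (α β : Type) [Fintype α] [DecidableEq α] [Fintype β] [DecidableEq β] :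
      Protocol U 0 1 0 (Bool × α) β (Bool × α) (Bool × β) (cobitAB α β)
  | sendBA (α β : Type) [Fintype α] [DecidableEq α] [Fintype β] [DecidableEq β] :
      Protocol U 0 0 1 α (Bool × β) (Bool × α) (Bool × β) (cobitBA α β)
  | comp {n n₂ f f₂ g g₂ : ℕ} {α β γ δ γ₂ δ₂ : Type} [Fintype γ] [Fintype δ]
      {P : Matrix (γ × δ) (α × β) ℂ} {Q : Matrix (γ₂ × δ₂) (γ × δ) ℂ}
      (hP : Protocol U n f g α β γ δ P) (hQ : Protocol U n₂ f₂ g₂ γ δ γ₂ δ₂ Q) :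
      Protocol U (n + n₂) (f + f₂) (g + g₂) α β γ₂ δ₂ (Q * P)

/-- The amplitudes `⟨z|⟨w| Φ^{⊗ k}` of `k` ebits, `Φ^{⊗ k} = 2^{-k/2} ∑_z |z⟩|z⟩`. -/
noncomputable def ebits (k : ℕ) (z w : Bits k) : ℂ :=
  if z = w then (((Real.sqrt (2 ^ k))⁻¹ : ℝ) : ℂ) else 0

/-- The isometry `|x⟩^A |y⟩^B ↦ |x⟩^A |y⟩^B (Φ^{AB})^{⊗ a}`, for strings `x` of `p` bits and `y` of
`q` bits: it supplies Alice and Bob with `a` ebits. -/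
noncomputable def supply (p q a : ℕ) :
    Matrix ((Bits p × Bits a) × (Bits q × Bits a)) (Bits p × Bits q) ℂ :=
  Matrix.of fun r s => if r.1.1 = s.1 ∧ r.2.1 = s.2 then ebits a r.1.2 r.2.2 else 0

/-- The isometry
`|x⟩^A |y⟩^B ↦ |x,y⟩^A |x,y⟩^B (Φ^{AB})^{⊗ b} (|0⟩^A)^{⊗ k} (|0⟩^B)^{⊗ l}`:
`p` cobits from Alice to Bob, `q` cobits from Bob to Alice, `b` ebits, and blank qubits, `k` of
Alice's and `l` of Bob's. -/
noncomputable def target (p q b k l : ℕ) :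
    Matrix ((Bits p × Bits q × Bits b × Bits k) × (Bits p × Bits q × Bits b × Bits l))
      (Bits p × Bits q) ℂ :=
  Matrix.of fun r s =>
    if (r.1.1 = s.1 ∧ r.1.2.1 = s.2) ∧ (r.2.1 = s.1 ∧ r.2.2.1 = s.2) ∧
        (r.1.2.2.2 = fun _ => false) ∧ (r.2.2.2.2 = fun _ => false)
    then ebits b r.1.2.2.1 r.2.2.2.1 else 0

open scoped Matrix.Norms.L2Operator in
/-- The operator norm of a matrix with respect to the Hilbert space (`ℓ²`) norms. -/
noncomputable def opNorm {m k : Type} [Fintype m] [Fintype k] [DecidableEq k]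
    (M : Matrix m k ℂ) : ℝ := ‖M‖

/-- The number `N` is within `ε n` of `n r`. -/
def Near (ε : ℝ) (n : ℕ) (N : ℕ) (r : ℝ) : Prop := |(N : ℝ) - n * r| ≤ ε * n

/-- `CleanProtocolAt U C₁ C₂ E ε n`: up to `ε`, `n` uses of `U` cleanly simulate `n C₁` cobits from
Alice to Bob, `n C₂` cobits from Bob to Alice and `n E` ebits, where a resource with a negative
coefficient is consumed instead of produced:

* `p`, `q`, `b` are the numbers of cobits (in the two directions) and of ebits that are produced;
* `f`, `g`, `a` are the numbers of cobits (in the two directions) and of ebits that are consumed;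
* the only other systems left at the end are `k` qubits of Alice's and `l` qubits of Bob's, all of
  them in the state `|0⟩`.  As isometries never lower dimensions, a party that holds (initially or
  through the consumed cobits) more qubits than the produced resources occupy must be left with the
  difference, which has rate `-E - C₂` for Alice and `-E - C₁` for Bob; apart from this unavoidable
  number (zero, when `C₁`, `C₂` and `E` are nonnegative), at most `ε n` qubits may be left. -/
def CleanProtocolAt {dA dB : ℕ} (U : Matrix (Fin dA × Fin dB) (Fin dA × Fin dB) ℂ)
    (C₁ C₂ E ε : ℝ) (n : ℕ) : Prop :=
  ∃ p q b f g a k l : ℕ,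
    Near ε n p (max C₁ 0) ∧ Near ε n q (max C₂ 0) ∧ Near ε n b (max E 0) ∧
    Near ε n f (max (-C₁) 0) ∧ Near ε n g (max (-C₂) 0) ∧ Near ε n a (max (-E) 0) ∧
    (k : ℝ) ≤ n * max (-E - C₂) 0 + ε * n ∧
    (l : ℝ) ≤ n * max (-E - C₁) 0 + ε * n ∧
    ∃ P : Matrix ((Bits p × Bits q × Bits b × Bits k) × (Bits p × Bits q × Bits b × Bits l))
        ((Bits p × Bits a) × (Bits q × Bits a)) ℂ,
      Protocol U n f g (Bits p × Bits a) (Bits q × Bits a)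
        (Bits p × Bits q × Bits b × Bits k) (Bits p × Bits q × Bits b × Bits l) P ∧
      opNorm (P * supply p q a - target p q b k l) ≤ ε

/-- The clean coherent capacity region of the gate `U`: the triples `(C₁, C₂, E)` such that `n` uses
of `U` cleanly yield cobits from Alice to Bob, cobits from Bob to Alice, and ebits at the asymptotic
rates `C₁`, `C₂` and `E`, with all errors and inefficiencies vanishing as `n → ∞`. -/
def clCCE {dA dB : ℕ} (U : Matrix (Fin dA × Fin dB) (Fin dA × Fin dB) ℂ) : Set (ℝ × ℝ × ℝ) :=
  {c | ∀ ε : ℝ, 0 < ε → ∀ᶠ n : ℕ in atTop, CleanProtocolAt U c.1 c.2.1 c.2.2 ε n}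

end CleanGate

/-! Run a protocol for `U` backwards. A gate is undone by the inverse gate. A local isometry needs
no undoing: followed by an embedding of its output register, it is just another embedding of its
input register. The cobit |x⟩ ↦ |x⟩|x⟩ from Alice to Bob is undone when Bob applies a Hadamard
transform to his copy and sends the result to Alice by a cobit, and she removes the phase, which
depends only on x and the received bit; this leaves |x⟩ with Alice and one ebit. Hence
(`Protocol.reversible`) reversal turns f and g consumed cobits into g and f, and yields f + g ebits.

The reversed protocol therefore maps |x,y⟩|x,y⟩Φ^b to |x⟩|y⟩Φ^(a+f+g) plus blanks. To get cobits
from this (`Approx.coherent_exchange`), proceed as in superdense coding: p + q + b ebits supply the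
uniform superposition of all |x,y⟩|x,y⟩ together with Φ^b, Bob writes his message as a phase on x
and Alice hers as a phase on y, and after the reversed protocol the inverse local Fourier transforms
reveal Bob's message to Alice and Alice's to Bob. The net gain is a + f + g - p - q - b ebits, of
rate -E - C₁ - C₂, and counting dimensions bounds the blanks (`Approx.reverse_bits`).

This needs p + q + b ebits at the start, which may exceed the net consumption. The uses are
therefore cut into M blocks, each fed by the ebits that the previous one returned
(`CatalyticProtocolAt.append`, `catalyticProtocolAt_of_blocks`); the stock needed beyond the net
consumption is then a small fraction of n for large M. The converse follows since the map of triples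
is an involution. -/

namespace CleanGate

/-! ### Isometries and the operator norm. -/

section Isometries

variable {α β γ δ κ κ' R : Type}

theorem IsIsometry.mul [Fintype γ] [Fintype δ] [DecidableEq α] [DecidableEq γ]
    {W : Matrix δ γ ℂ} {V : Matrix γ α ℂ} (hW : IsIsometry W) (hV : IsIsometry V) :
    IsIsometry (W * V) := by
  unfold IsIsometry at *
  rw [Matrix.conjTranspose_mul, Matrix.mul_assoc, ← Matrix.mul_assoc Wᴴ, hW, Matrix.one_mul, hV]

theorem IsIsometry.kronecker [Fintype γ] [Fintype δ] [DecidableEq α] [DecidableEq β]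
    {V : Matrix γ α ℂ} {W : Matrix δ β ℂ} (hV : IsIsometry V) (hW : IsIsometry W) :
    IsIsometry (V ⊗ₖ W) := by
  unfold IsIsometry at *
  rw [Matrix.conjTranspose_kronecker, ← Matrix.mul_kronecker_mul, hV, hW, Matrix.one_kronecker_one]

theorem isIsometry_one [Fintype α] [DecidableEq α] : IsIsometry (1 : Matrix α α ℂ) := by
  simp [IsIsometry]

theorem IsIsometry.submatrix [Fintype γ] [Fintype δ] [DecidableEq α] [DecidableEq β]
    {V : Matrix γ α ℂ} (hV : IsIsometry V) (e : δ ≃ γ) (e' : β ≃ α) :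
    IsIsometry (V.submatrix e e') := by
  unfold IsIsometry at *
  rw [Matrix.conjTranspose_submatrix, Matrix.submatrix_mul_equiv, hV, Matrix.submatrix_one_equiv]

open scoped Matrix.Norms.L2Operator in
theorem IsIsometry.opNorm_le_one [Fintype α] [Fintype γ] [DecidableEq α] {V : Matrix γ α ℂ}
    (hV : IsIsometry V) : opNorm V ≤ 1 := by
  have h := Matrix.l2_opNorm_conjTranspose_mul_self V
  unfold IsIsometry at hV
  rw [hV] at h
  have h1 : ‖(1 : Matrix α α ℂ)‖ ≤ 1 := by
    rw [← Matrix.diagonal_one, Matrix.l2_opNorm_diagonal]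
    exact (pi_norm_le_iff_of_nonneg zero_le_one).2 (by simp)
  unfold opNorm
  nlinarith [norm_nonneg V]

open scoped Matrix.Norms.L2Operator in
theorem opNorm_mul_le [Fintype α] [Fintype β] [Fintype γ] [DecidableEq α] [DecidableEq β]
    (M : Matrix γ β ℂ) (N : Matrix β α ℂ) : opNorm (M * N) ≤ opNorm M * opNorm N :=
  Matrix.l2_opNorm_mul M N

open scoped Matrix.Norms.L2Operator in
theorem opNorm_nonneg [Fintype α] [Fintype γ] [DecidableEq α]
    (M : Matrix γ α ℂ) : 0 ≤ opNorm M := norm_nonneg M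

open scoped Matrix.Norms.L2Operator in
theorem opNorm_add_le [Fintype α] [Fintype γ] [DecidableEq α]
    (M N : Matrix γ α ℂ) : opNorm (M + N) ≤ opNorm M + opNorm N := norm_add_le M N

open scoped Matrix.Norms.L2Operator in
theorem opNorm_zero [Fintype α] [Fintype γ] [DecidableEq α] :
    opNorm (0 : Matrix γ α ℂ) = 0 := norm_zero

open scoped Matrix.Norms.L2Operator in
theorem opNorm_sub_comm [Fintype α] [Fintype γ] [DecidableEq α]
    (M N : Matrix γ α ℂ) : opNorm (M - N) = opNorm (N - M) := norm_sub_rev M N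

theorem IsIsometry.opNorm_mul_le [Fintype α] [Fintype γ] [Fintype κ] [DecidableEq α]
    [DecidableEq κ] {V : Matrix γ α ℂ} (hV : IsIsometry V) (M : Matrix α κ ℂ) :
    opNorm (V * M) ≤ opNorm M :=
  (CleanGate.opNorm_mul_le V M).trans
    (mul_le_of_le_one_left (opNorm_nonneg M) hV.opNorm_le_one)

theorem opNorm_mul_le_of_isIsometry [Fintype α] [Fintype γ] [Fintype κ] [DecidableEq α]
    [DecidableEq κ] (M : Matrix γ α ℂ) {T : Matrix α κ ℂ} (hT : IsIsometry T) :
    opNorm (M * T) ≤ opNorm M :=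
  (CleanGate.opNorm_mul_le M T).trans
    (mul_le_of_le_one_right (opNorm_nonneg M) hT.opNorm_le_one)

open scoped Matrix.Norms.L2Operator in
-- The squared norm of a vector splits over the basis label of the second factor, and M acts on each
-- slice separately.
theorem opNorm_kronecker_one_le [Fintype α] [Fintype γ] [Fintype κ] [DecidableEq α]
    [DecidableEq κ] (M : Matrix γ α ℂ) :
    opNorm (M ⊗ₖ (1 : Matrix κ κ ℂ)) ≤ opNorm M := by
  unfold opNorm
  rw [Matrix.l2_opNorm_def]
  refine ContinuousLinearMap.opNorm_le_bound _ (norm_nonneg _) fun v => ?_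
  have key : ∀ j : κ, ∑ i, ‖∑ a, M i a * v (a, j)‖ ^ 2 ≤ ‖M‖ ^ 2 * ∑ a, ‖v (a, j)‖ ^ 2 := by
    intro j
    have h := Matrix.l2_opNorm_mulVec M (WithLp.toLp 2 fun a => v (a, j))
    have h2 := pow_le_pow_left₀ (norm_nonneg _) h 2
    rw [mul_pow, EuclideanSpace.norm_sq_eq, EuclideanSpace.norm_sq_eq] at h2
    simpa [Matrix.mulVec, dotProduct] using h2
  refine le_of_sq_le_sq ?_ (by positivity)
  rw [mul_pow, EuclideanSpace.norm_sq_eq, EuclideanSpace.norm_sq_eq, Fintype.sum_prod_type_right,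
    Fintype.sum_prod_type_right, Finset.mul_sum]
  refine Finset.sum_le_sum fun j _ => le_trans (le_of_eq ?_) (key j)
  refine Finset.sum_congr rfl fun i _ => ?_
  congr 2
  simp [Matrix.mulVec, dotProduct, Fintype.sum_prod_type, Matrix.one_apply]

theorem opNorm_submatrix_equiv_le [Fintype α] [Fintype γ] [Fintype δ] [DecidableEq α]
    [DecidableEq γ] (M : Matrix γ α ℂ) (e : δ ≃ γ) :
    opNorm (M.submatrix e id) ≤ opNorm M := by
  have h : M.submatrix e id = (1 : Matrix γ γ ℂ).submatrix e id * M := by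
    ext i j
    simp [Matrix.mul_apply, Matrix.one_apply]
  rw [h]
  refine IsIsometry.opNorm_mul_le ?_ M
  exact (isIsometry_one (α := γ)).submatrix e (Equiv.refl γ)

theorem IsIsometry.card_le [Fintype α] [Fintype γ] [DecidableEq α] {V : Matrix γ α ℂ}
    (hV : IsIsometry V) : Fintype.card α ≤ Fintype.card γ := by
  have h1 : (Vᴴ * V).rank = Fintype.card α := by
    rw [show Vᴴ * V = 1 from hV, Matrix.rank_one]
  exact h1 ▸ (Matrix.rank_mul_le_right _ _).trans (Matrix.rank_le_card_height V)

end Isometries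

/-! ### Basis maps and maximally entangled superpositions. -/

section BasisMaps

variable {α β γ δ κ κ' R : Type}

/-- The operator `|s⟩ ↦ |e s⟩` given by a map between computational bases. -/
def inj [DecidableEq γ] (e : α → γ) : Matrix γ α ℂ :=
  Matrix.of fun r s => if r = e s then 1 else 0

theorem inj_apply [DecidableEq γ] (e : α → γ) (r : γ) (s : α) :
    inj e r s = if r = e s then 1 else 0 := rfl

theorem isIsometry_inj [Fintype γ] [DecidableEq γ] [DecidableEq α] {e : α → γ}
    (he : Function.Injective e) : IsIsometry (inj e) := by
  ext i j
  simp only [Matrix.mul_apply, Matrix.conjTranspose_apply, inj_apply, Matrix.one_apply, apply_ite,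
    star_one, star_zero, mul_one, mul_zero]
  rw [Finset.sum_eq_single (e j)]
  · simp [he.eq_iff, eq_comm]
  · intro b _ hb; simp [hb]
  · simp

theorem inj_mul_inj [Fintype γ] [DecidableEq γ] [DecidableEq δ] (F : γ → δ) (G : α → γ) :
    inj F * inj G = inj (F ∘ G) := by
  ext i j
  simp [Matrix.mul_apply, inj_apply]

theorem inj_kronecker_inj [DecidableEq γ] [DecidableEq δ] (F : α → γ) (G : β → δ) :
    inj F ⊗ₖ inj G = inj (Prod.map F G) := by
  ext ⟨i, i'⟩ ⟨j, j'⟩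
  simp only [Matrix.kroneckerMap_apply, inj_apply, Prod.map, Prod.mk.injEq]
  split_ifs <;> simp_all

theorem inj_equiv_mul [Fintype α] [DecidableEq γ] (e : α ≃ γ) (M : Matrix α κ ℂ) :
    inj e * M = M.submatrix e.symm id := by
  ext i j
  rw [Matrix.mul_apply, Finset.sum_eq_single (e.symm i)]
  · simp [inj_apply]
  · intro b _ hb
    rw [inj_apply, if_neg, zero_mul]
    rintro rfl; simp at hb
  · simp

theorem inj_kronecker_inj_equiv_mul [Fintype α] [Fintype β] [DecidableEq γ] [DecidableEq δ]
    (e : α ≃ γ) (e' : β ≃ δ) (M : Matrix (α × β) κ ℂ) :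
    (inj e ⊗ₖ inj e') * M = M.submatrix (Prod.map e.symm e'.symm) id := by
  rw [inj_kronecker_inj]
  exact inj_equiv_mul (Equiv.prodCongr e e') M

theorem mul_inj [Fintype γ] [DecidableEq γ] (M : Matrix κ γ ℂ) (e : α → γ) :
    M * inj e = M.submatrix id e := by
  ext i j
  simp [Matrix.mul_apply, inj_apply]

/-- The amplitude of each term of a maximally entangled state on two copies of `B`. -/
noncomputable def amp (B : Type) [Fintype B] : ℂ := (((Real.sqrt (Fintype.card B))⁻¹ : ℝ) : ℂ)

theorem amp_prod (B S : Type) [Fintype B] [Fintype S] : amp (B × S) = amp B * amp S := by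
  simp [amp, mul_comm]

theorem star_amp_mul_amp (B : Type) [Fintype B] [Nonempty B] :
    star (amp B) * amp B * Fintype.card B = 1 := by
  have h : (0 : ℝ) < Fintype.card B := by exact_mod_cast Fintype.card_pos
  have h2 : (Real.sqrt (Fintype.card B))⁻¹ * (Real.sqrt (Fintype.card B))⁻¹ *
      (Fintype.card B : ℝ) = 1 := by
    rw [← mul_inv, Real.mul_self_sqrt h.le, inv_mul_cancel₀ h.ne']
  have := congrArg (fun t : ℝ => (t : ℂ)) h2
  simpa [amp] using this

theorem amp_of_unique (B : Type) [Fintype B] [Unique B] : amp B = 1 := by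
  simp [amp]

/-- The operator `|k⟩ ↦ |B|^{-1/2} ∑_z |h k z⟩`. -/
noncomputable def spread {B : Type} [Fintype B] [DecidableEq R] (h : κ → B → R) : Matrix R κ ℂ :=
  Matrix.of fun r k => ∑ z, if r = h k z then amp B else 0

variable {B S : Type} [Fintype B] [Fintype S]

theorem spread_apply [DecidableEq R] (h : κ → B → R) (r : R) (k : κ) :
    spread h r k = ∑ z, if r = h k z then amp B else 0 := rfl

theorem inj_mul_spread [Fintype γ] [DecidableEq γ] [DecidableEq δ] (F : γ → δ) (h : κ → B → γ) :
    inj F * spread h = spread fun k z => F (h k z) := by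
  ext i j
  simp only [Matrix.mul_apply, inj_apply, spread_apply, Finset.mul_sum]
  rw [Finset.sum_comm]
  simp

theorem spread_mul_inj [Fintype κ] [DecidableEq κ] [DecidableEq R] (h : κ → B → R) (t : κ' → κ) :
    spread h * inj t = spread fun k z => h (t k) z := by
  ext i j
  simp [Matrix.mul_apply, inj_apply, spread_apply]

theorem spread_congr_equiv [DecidableEq R] (h : κ → B → R) (e : S ≃ B) :
    spread h = spread fun k z => h k (e z) := by
  ext i j
  have hc : amp B = amp S := by simp [amp, Fintype.card_congr e]
  simp only [spread_apply, hc]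
  exact (e.sum_comp fun z => if i = h j z then amp S else 0).symm

theorem isIsometry_spread [Nonempty B] [Fintype R] [DecidableEq R] [DecidableEq κ]
    {h : κ → B → R} (hh : Function.Injective fun s : κ × B => h s.1 s.2) :
    IsIsometry (spread h) := by
  classical
  ext i j
  have h1 : ∀ z w, h i z = h j w ↔ i = j ∧ z = w := fun z w => by
    rw [← Prod.mk.injEq]; exact hh.eq_iff (a := (i, z)) (b := (j, w))
  simp only [Matrix.mul_apply, Matrix.conjTranspose_apply, spread_apply, star_sum,
    Finset.sum_mul_sum, Matrix.one_apply]
  rw [Finset.sum_comm]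
  have h2 : ∀ z : B, (∑ r : R, ∑ w : B, star (if r = h i z then amp B else 0) *
      (if r = h j w then amp B else 0)) = if i = j then star (amp B) * amp B else 0 := by
    intro z
    rw [Finset.sum_eq_single (h i z)]
    · simp only [if_true, h1, mul_ite, mul_zero]
      by_cases hij : i = j <;> simp [hij]
    · intro b _ hb; simp [hb]
    · simp
  simp only [h2]
  by_cases hij : i = j
  · have := star_amp_mul_amp B
    simp [hij]
    rw [← this]; simp; ring
  · simp [hij]

theorem supply_eq_spread (p q a : ℕ) :
    supply p q a = spread fun (s : Bits p × Bits q) (z : Bits a) => ((s.1, z), (s.2, z)) := by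
  ext ⟨⟨x, z⟩, ⟨y, w⟩⟩ ⟨x', y'⟩
  have : amp (Bits a) = (((Real.sqrt (2 ^ a))⁻¹ : ℝ) : ℂ) := by simp [amp]
  rw [spread_apply, this]
  simp only [supply, ebits, Matrix.of_apply, Prod.mk.injEq]
  rw [Finset.sum_eq_single z]
  · split_ifs <;> simp_all
  · rintro b - hb
    rw [if_neg]; tauto
  · simp

set_option synthInstance.maxSize 1000 in
theorem target_eq_spread (p q b k l : ℕ) :
    target p q b k l = spread
      (R := (Bits p × Bits q × Bits b × Bits k) × (Bits p × Bits q × Bits b × Bits l))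
      fun (s : Bits p × Bits q) (z : Bits b) =>
        ((s.1, s.2, z, fun _ => false), (s.1, s.2, z, fun _ => false)) := by
  ext ⟨⟨x, y, z, k⟩, ⟨x₁, y₁, w, l⟩⟩ ⟨x', y'⟩
  have : amp (Bits b) = (((Real.sqrt (2 ^ b))⁻¹ : ℝ) : ℂ) := by simp [amp]
  rw [spread_apply, this]
  simp only [target, ebits, Matrix.of_apply, Prod.mk.injEq]
  rw [Finset.sum_eq_single z]
  · split_ifs <;> simp_all
  · rintro b - hb
    rw [if_neg]; tauto
  · simp

end BasisMaps

/-! ### Operators in the presence of spectator registers. -/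

section Spectators

variable {α β γ δ κ κ' κ₁ α' β' α₁ β₁ : Type}

/-- The operator `P` acting in the presence of spectator registers `α'` (Alice) and `β'` (Bob). -/
def ampliate [DecidableEq α'] [DecidableEq β'] (P : Matrix (γ × δ) (α × β) ℂ) :
    Matrix ((γ × α') × (δ × β')) ((α × α') × (β × β')) ℂ :=
  (P ⊗ₖ (1 : Matrix (α' × β') (α' × β') ℂ)).submatrix
    (Equiv.prodProdProdComm γ α' δ β') (Equiv.prodProdProdComm α α' β β')

theorem ampliate_apply [DecidableEq α'] [DecidableEq β'] (P : Matrix (γ × δ) (α × β) ℂ)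
    (r : (γ × α') × (δ × β')) (s : (α × α') × (β × β')) :
    ampliate P r s = P (r.1.1, r.2.1) (s.1.1, s.2.1) *
      (1 : Matrix (α' × β') (α' × β') ℂ) (r.1.2, r.2.2) (s.1.2, s.2.2) := rfl

/-- The states `ψ`, indexed by part of the output of `T`, together with the rest of that output. -/
def ctx [Fintype κ] [Fintype α'] [Fintype β'] [DecidableEq α'] [DecidableEq β']
    (ψ : Matrix (α × β) κ ℂ) (T : Matrix (κ × (α' × β')) κ' ℂ) :
    Matrix ((α × α') × (β × β')) κ' ℂ :=
  ((ψ ⊗ₖ (1 : Matrix (α' × β') (α' × β') ℂ)) * T).submatrix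
    (Equiv.prodProdProdComm α α' β β') id

variable [Fintype κ] [Fintype α'] [Fintype β'] [DecidableEq α'] [DecidableEq β']

theorem ctx_apply (ψ : Matrix (α × β) κ ℂ) (T : Matrix (κ × (α' × β')) κ' ℂ)
    (r : (α × α') × (β × β')) (k' : κ') :
    ctx ψ T r k' = ∑ k, ψ (r.1.1, r.2.1) k * T (k, (r.1.2, r.2.2)) k' := by
  simp only [ctx, Matrix.mul_apply, Matrix.submatrix_apply, Matrix.kroneckerMap_apply,
    Matrix.one_apply, mul_ite, mul_one, mul_zero, ite_mul, zero_mul, id]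
  rw [Fintype.sum_prod_type]
  simp

theorem ampliate_mul_ctx [Fintype α] [Fintype β] (P : Matrix (γ × δ) (α × β) ℂ)
    (ψ : Matrix (α × β) κ ℂ) (T : Matrix (κ × (α' × β')) κ' ℂ) :
    ampliate (α' := α') (β' := β') P * ctx ψ T = ctx (P * ψ) T := by
  rw [ampliate, ctx, ctx, Matrix.submatrix_mul_equiv, ← Matrix.mul_assoc,
    ← Matrix.mul_kronecker_mul, Matrix.one_mul]

theorem ampliate_mul_ampliate [Fintype γ] [Fintype δ] (Q : Matrix (α₁ × β₁) (γ × δ) ℂ)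
    (P : Matrix (γ × δ) (α × β) ℂ) :
    ampliate (α' := α') (β' := β') Q * ampliate (α' := α') (β' := β') P =
      ampliate (Q * P) := by
  rw [ampliate, ampliate, ampliate, Matrix.submatrix_mul_equiv, ← Matrix.mul_kronecker_mul,
    Matrix.one_mul]

/-- An operator on the index space of the states may be regarded as part of the preparation `T`;
this is how Fourier transforms of the messages enter and leave. -/
theorem ctx_mul [Fintype κ₁] [Fintype κ'] (ψ : Matrix (α × β) κ₁ ℂ) (M : Matrix κ₁ κ ℂ)
    (T : Matrix (κ × (α' × β')) κ' ℂ) :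
    ctx (ψ * M) T = ctx ψ ((M ⊗ₖ (1 : Matrix (α' × β') (α' × β') ℂ)) * T) := by
  rw [ctx, ctx, ← Matrix.mul_assoc, ← Matrix.mul_kronecker_mul, Matrix.one_mul]

theorem ctx_mul_right [Fintype κ'] (ψ : Matrix (α × β) κ ℂ) (T : Matrix (κ × (α' × β')) κ' ℂ)
    (M : Matrix κ' κ₁ ℂ) : ctx ψ T * M = ctx ψ (T * M) := by
  ext r k
  simp only [ctx, Matrix.mul_apply, Matrix.submatrix_apply, id, Finset.sum_mul, Finset.mul_sum,
    mul_assoc]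
  exact Finset.sum_comm

theorem ctx_sub (ψ φ : Matrix (α × β) κ ℂ) (T : Matrix (κ × (α' × β')) κ' ℂ) :
    ctx (ψ - φ) T = ctx ψ T - ctx φ T := by
  ext r k
  simp [ctx_apply, sub_mul, Finset.sum_sub_distrib]

theorem opNorm_ctx_le [Fintype α] [Fintype β] [Fintype κ'] [DecidableEq α] [DecidableEq β]
    [DecidableEq κ] [DecidableEq κ'] (ψ : Matrix (α × β) κ ℂ)
    {T : Matrix (κ × (α' × β')) κ' ℂ} (hT : IsIsometry T) : opNorm (ctx ψ T) ≤ opNorm ψ :=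
  (opNorm_submatrix_equiv_le _ _).trans
    ((opNorm_mul_le_of_isIsometry _ hT).trans (opNorm_kronecker_one_le ψ))

variable {B S : Type} [Fintype B] [Fintype S]

theorem ctx_spread [DecidableEq κ] [DecidableEq α] [DecidableEq β] (h : κ → B → α × β)
    (t : κ' → S → κ × (α' × β')) :
    ctx (spread h) (spread t) = spread fun k' (w : S × B) =>
      (((h (t k' w.1).1 w.2).1, (t k' w.1).2.1), ((h (t k' w.1).1 w.2).2, (t k' w.1).2.2)) := by
  ext ⟨⟨a, a'⟩, ⟨b, b'⟩⟩ k'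
  simp only [ctx_apply, spread_apply, Fintype.sum_prod_type, Finset.sum_mul_sum, amp_prod]
  rw [Finset.sum_comm]
  simp_rw [Finset.sum_comm (s := (Finset.univ : Finset κ))]
  rw [Finset.sum_comm]
  refine Finset.sum_congr rfl fun z _ => Finset.sum_congr rfl fun w _ => ?_
  rw [Finset.sum_eq_single (t k' z).1]
  · have h1 : ((t k' z).1, (a', b')) = t k' z ↔ (a', b') = (t k' z).2 := by simp [Prod.ext_iff]
    have h2 : ((a, a'), (b, b')) = (((h (t k' z).1 w).1, (t k' z).2.1),
        ((h (t k' z).1 w).2, (t k' z).2.2)) ↔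
        (a, b) = h (t k' z).1 w ∧ (a', b') = (t k' z).2 := by
      simp only [Prod.ext_iff]; tauto
    simp only [h1, h2, ite_and]
    split_ifs <;> ring
  · intro k _ hk
    rw [if_neg (c := (k, a', b') = _) (fun h => hk (by rw [← h])), mul_zero]
  · simp

end Spectators

/-! ### Protocols and the state transformations they perform. -/

section Protocols

variable {dA dB : ℕ} {U : Matrix (Fin dA × Fin dB) (Fin dA × Fin dB) ℂ}

theorem gateOp_eq_ampliate (α β : Type) [DecidableEq α] [DecidableEq β] :
    gateOp U α β = ampliate (α' := α) (β' := β) U := by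
  ext r s
  simp [gateOp, ampliate_apply, Matrix.one_apply]

theorem cobitAB_eq_inj (α β : Type) [DecidableEq α] [DecidableEq β] :
    cobitAB α β = inj fun s : (Bool × α) × β => (s.1, (s.1.1, s.2)) := by
  ext r s
  simp [cobitAB, inj_apply, Prod.ext_iff]

theorem cobitBA_eq_inj (α β : Type) [DecidableEq α] [DecidableEq β] :
    cobitBA α β = inj fun s : α × (Bool × β) => ((s.2.1, s.1), s.2) := by
  ext r s
  simp [cobitBA, inj_apply, Prod.ext_iff]

namespace Protocol

variable {n f g : ℕ} {α β γ δ : Type} {P : Matrix (γ × δ) (α × β) ℂ}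

/-- Every elementary operation is an isometry. The instances are quantified because the indices of
`Protocol` carry none; in a composition the two choices on the middle registers are identified by
uniqueness. -/
theorem exists_isIsometry (hU : U ∈ Matrix.unitaryGroup (Fin dA × Fin dB) ℂ)
    (hP : Protocol U n f g α β γ δ P) : ∃ (_ : Fintype γ) (_ : Fintype δ) (_ : DecidableEq α)
      (_ : DecidableEq β), IsIsometry P := by
  classical
  induction hP with
  | localOps V W hV hW => exact ⟨_, _, _, _, hV.kronecker hW⟩
  | gate α β =>
    refine ⟨inferInstance, inferInstance, inferInstance, inferInstance, ?_⟩
    rw [gateOp_eq_ampliate]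
    have h : IsIsometry U := Matrix.mem_unitaryGroup_iff'.1 hU
    exact (h.kronecker (isIsometry_one (α := α × β))).submatrix _ _
  | sendAB α β =>
    refine ⟨inferInstance, inferInstance, inferInstance, inferInstance, ?_⟩
    rw [cobitAB_eq_inj]
    exact isIsometry_inj (by rintro ⟨⟨a, b⟩, c⟩ ⟨⟨a', b'⟩, c'⟩ h; simp_all)
  | sendBA α β =>
    refine ⟨inferInstance, inferInstance, inferInstance, inferInstance, ?_⟩
    rw [cobitBA_eq_inj]
    exact isIsometry_inj (by rintro ⟨a, b, c⟩ ⟨a', b', c'⟩ h; simp_all)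
  | @comp _ _ _ _ _ _ _ _ _ _ _ _ j₁ j₂ _ _ _ _ ih1 ih2 =>
    obtain ⟨i1, i2, i3, i4, h1⟩ := ih1
    obtain ⟨i5, i6, i7, i8, h2⟩ := ih2
    obtain rfl := Subsingleton.elim i1 j₁
    obtain rfl := Subsingleton.elim i2 j₂
    exact ⟨i5, i6, i3, i4, IsIsometry.mul h2 h1⟩

theorem isIsometry (hU : U ∈ Matrix.unitaryGroup (Fin dA × Fin dB) ℂ)
    (hP : Protocol U n f g α β γ δ P) [Fintype γ] [Fintype δ] [DecidableEq α]
    [DecidableEq β] : IsIsometry P := by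
  obtain ⟨_, _, _, _, h⟩ := hP.exists_isIsometry hU
  convert h

theorem comp' {n₂ f₂ g₂ N F G : ℕ} {γ₂ δ₂ : Type} [Fintype γ] [Fintype δ]
    {Q : Matrix (γ₂ × δ₂) (γ × δ) ℂ} (hP : Protocol U n f g α β γ δ P)
    (hQ : Protocol U n₂ f₂ g₂ γ δ γ₂ δ₂ Q) (hN : n + n₂ = N) (hF : f + f₂ = F)
    (hG : g + g₂ = G) : Protocol U N F G α β γ₂ δ₂ (Q * P) := by
  subst hN hF hG
  exact comp hP hQ

theorem reindex {α₂ β₂ γ₂ δ₂ : Type} [Fintype α] [DecidableEq α] [Fintype β] [DecidableEq β]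
    [Fintype γ] [DecidableEq γ] [Fintype δ] [DecidableEq δ] (hP : Protocol U n f g α β γ δ P)
    (e₁ : α₂ ≃ α) (e₂ : β₂ ≃ β) (e₃ : γ₂ ≃ γ) (e₄ : δ₂ ≃ δ) :
    Protocol U n f g α₂ β₂ γ₂ δ₂
      (P.submatrix (Equiv.prodCongr e₃ e₄) (Equiv.prodCongr e₁ e₂)) := by
  classical
  let _ := Fintype.ofEquiv α e₁.symm
  let _ := Fintype.ofEquiv β e₂.symm
  let _ := Fintype.ofEquiv γ e₃.symm
  let _ := Fintype.ofEquiv δ e₄.symm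
  have h1 : Protocol U 0 0 0 α₂ β₂ α β (inj e₁ ⊗ₖ inj e₂) :=
    localOps _ _ (isIsometry_inj e₁.injective) (isIsometry_inj e₂.injective)
  have h2 : Protocol U 0 0 0 γ δ γ₂ δ₂ (inj e₃.symm ⊗ₖ inj e₄.symm) :=
    localOps _ _ (isIsometry_inj e₃.symm.injective) (isIsometry_inj e₄.symm.injective)
  have h := comp' (comp' h1 hP (zero_add n) (zero_add f) (zero_add g)) h2 (add_zero n)
    (add_zero f) (add_zero g)
  convert h using 1
  rw [inj_kronecker_inj_equiv_mul, inj_kronecker_inj, mul_inj]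
  rfl

theorem ampliate (hP : Protocol U n f g α β γ δ P) (α' β' : Type) [Fintype α'] [DecidableEq α']
    [Fintype β'] [DecidableEq β'] :
    Protocol U n f g (α × α') (β × β') (γ × α') (δ × β') (ampliate P) := by
  induction hP with
  | @localOps α β γ δ _ _ _ _ _ _ V W hV hW =>
    have h : CleanGate.ampliate (V ⊗ₖ W) =
        (V ⊗ₖ (1 : Matrix α' α' ℂ)) ⊗ₖ (W ⊗ₖ (1 : Matrix β' β' ℂ)) := by
      ext r s
      simp only [ampliate_apply, Matrix.kroneckerMap_apply, Matrix.one_apply, Prod.mk.injEq]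
      split_ifs <;> simp_all
    rw [h]
    exact localOps _ _ (hV.kronecker isIsometry_one) (hW.kronecker isIsometry_one)
  | gate α β =>
    have h := (gate (U := U) (α × α') (β × β')).reindex (Equiv.prodAssoc (Fin dA) α α')
      (Equiv.prodAssoc (Fin dB) β β') (Equiv.prodAssoc (Fin dA) α α')
      (Equiv.prodAssoc (Fin dB) β β')
    convert h using 1
    ext r s
    simp only [gateOp_eq_ampliate, ampliate_apply, Matrix.one_apply, Matrix.submatrix_apply,
      Equiv.prodCongr_apply, Equiv.prodAssoc_apply, Prod.map, Prod.mk.injEq]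
    split_ifs <;> simp_all
  | sendAB α β =>
    have h := (sendAB (U := U) (α × α') (β × β')).reindex (Equiv.prodAssoc Bool α α')
      (Equiv.refl _) (Equiv.prodAssoc Bool α α') (Equiv.prodAssoc Bool β β')
    convert h using 1
    ext r s
    simp only [cobitAB_eq_inj, ampliate_apply, Matrix.one_apply, Matrix.submatrix_apply, inj_apply,
      Equiv.prodCongr_apply, Equiv.prodAssoc_apply, Prod.map, Prod.ext_iff, Equiv.refl_apply]
    split_ifs <;> simp_all
  | sendBA α β =>
    have h := (sendBA (U := U) (α × α') (β × β')).reindex (Equiv.refl _)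
      (Equiv.prodAssoc Bool β β') (Equiv.prodAssoc Bool α α') (Equiv.prodAssoc Bool β β')
    convert h using 1
    ext r s
    simp only [cobitBA_eq_inj, ampliate_apply, Matrix.one_apply, Matrix.submatrix_apply, inj_apply,
      Equiv.prodCongr_apply, Equiv.prodAssoc_apply, Prod.map, Prod.ext_iff, Equiv.refl_apply]
    split_ifs <;> simp_all
  | comp hP hQ ih1 ih2 =>
    rw [← ampliate_mul_ampliate]
    exact comp ih1 ih2

/-- Local isometries cannot shrink a register, and each received cobit adds a qubit. This keeps the
subtractions in `Approx.reverse_bits` from being truncated. -/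
theorem card_le (hP : Protocol U n f g α β γ δ P) :
    Nat.card α * 2 ^ g ≤ Nat.card γ ∧ Nat.card β * 2 ^ f ≤ Nat.card δ := by
  induction hP with
  | localOps V W hV hW => simpa using ⟨hV.card_le, hW.card_le⟩
  | gate α β => simp
  | sendAB α β => simp [mul_comm]
  | sendBA α β => simp [mul_comm]
  | comp hP hQ ih1 ih2 =>
    rw [pow_add, pow_add, ← mul_assoc, ← mul_assoc]
    exact ⟨(Nat.mul_le_mul_right _ ih1.1).trans ih2.1, (Nat.mul_le_mul_right _ ih1.2).trans ih2.2⟩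

/-- The registers never become empty, by `card_le`, so the first use of the gate acts on a nonzero
space. -/
theorem dim_pos (hP : Protocol U n f g α β γ δ P) (hn : n ≠ 0) (hα : 0 < Nat.card α)
    (hβ : 0 < Nat.card β) : 0 < dA ∧ 0 < dB := by
  induction hP with
  | localOps V W hV hW => exact absurd rfl hn
  | gate α β =>
    rw [Nat.card_prod, Nat.card_fin] at hα hβ
    exact ⟨Nat.pos_of_mul_pos_right hα, Nat.pos_of_mul_pos_right hβ⟩
  | sendAB α β => exact absurd rfl hn
  | sendBA α β => exact absurd rfl hn
  | @comp n n₂ f f₂ g g₂ α β γ δ γ₂ δ₂ _ _ P Q hP hQ ih1 ih2 =>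
    by_cases h : n = 0
    · have h2 := hP.card_le
      exact ih2 (by omega) (lt_of_lt_of_le (by positivity) h2.1)
        (lt_of_lt_of_le (by positivity) h2.2)
    · exact ih1 h hα hβ

end Protocol

/-- A protocol with the given resources maps the states `ψ` to the states `φ`. -/
def Reaches (U : Matrix (Fin dA × Fin dB) (Fin dA × Fin dB) ℂ) (n f g : ℕ)
    {α β γ δ κ : Type} [Fintype α] [Fintype β] (ψ : Matrix (α × β) κ ℂ)
    (φ : Matrix (γ × δ) κ ℂ) : Prop :=
  ∃ P, Protocol U n f g α β γ δ P ∧ P * ψ = φ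

/-- A protocol with the given resources maps the states `ψ` to states `ε`-close to `φ`. -/
def Approx (U : Matrix (Fin dA × Fin dB) (Fin dA × Fin dB) ℂ) (n f g : ℕ) (ε : ℝ)
    {α β γ δ κ : Type} [Fintype α] [Fintype β] [Fintype γ] [Fintype δ] [Fintype κ] [DecidableEq κ]
    (ψ : Matrix (α × β) κ ℂ) (φ : Matrix (γ × δ) κ ℂ) : Prop :=
  ∃ P, Protocol U n f g α β γ δ P ∧ opNorm (P * ψ - φ) ≤ ε

variable {n f g n₂ f₂ g₂ : ℕ} {α β γ δ γ₂ δ₂ κ κ' α' β' : Type}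
  [Fintype α] [Fintype β]
  {ψ : Matrix (α × β) κ ℂ} {φ : Matrix (γ × δ) κ ℂ} {χ : Matrix (γ₂ × δ₂) κ ℂ}

theorem Reaches.mul_right [Fintype κ] (h : Reaches U n f g ψ φ) (M : Matrix κ κ' ℂ) :
    Reaches U n f g (ψ * M) (φ * M) := by
  obtain ⟨P, hP, rfl⟩ := h
  exact ⟨P, hP, (Matrix.mul_assoc _ _ _).symm⟩

theorem Reaches.with_ctx [Fintype κ] [Fintype α'] [Fintype β'] [DecidableEq α'] [DecidableEq β']
    (h : Reaches U n f g ψ φ) (T : Matrix (κ × (α' × β')) κ' ℂ) :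
    Reaches U n f g (ctx ψ T) (ctx φ T) := by
  obtain ⟨P, hP, rfl⟩ := h
  exact ⟨_, hP.ampliate α' β', ampliate_mul_ctx _ _ _⟩

variable [Fintype γ] [Fintype δ]

theorem Reaches.trans {N F G : ℕ} (h₁ : Reaches U n f g ψ φ) (h₂ : Reaches U n₂ f₂ g₂ φ χ)
    (hN : n + n₂ = N) (hF : f + f₂ = F) (hG : g + g₂ = G) :
    Reaches U N F G ψ χ := by
  obtain ⟨P, hP, rfl⟩ := h₁
  obtain ⟨Q, hQ, rfl⟩ := h₂
  exact ⟨Q * P, hP.comp' hQ hN hF hG, Matrix.mul_assoc _ _ _⟩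

theorem Reaches.trans_local (h₁ : Reaches U n f g ψ φ) (h₂ : Reaches U 0 0 0 φ χ) :
    Reaches U n f g ψ χ :=
  h₁.trans h₂ rfl rfl rfl

theorem Reaches.local_trans (h₁ : Reaches U 0 0 0 ψ φ) (h₂ : Reaches U n f g φ χ) :
    Reaches U n f g ψ χ :=
  h₁.trans h₂ (zero_add n) (zero_add f) (zero_add g)

theorem Reaches.localOps [DecidableEq α] [DecidableEq β] (ψ : Matrix (α × β) κ ℂ)
    {V : Matrix γ α ℂ} {W : Matrix δ β ℂ} (hV : IsIsometry V) (hW : IsIsometry W) :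
    Reaches U 0 0 0 ψ ((V ⊗ₖ W) * ψ) :=
  ⟨_, .localOps V W hV hW, rfl⟩

theorem Reaches.spread [DecidableEq α] [DecidableEq β] [DecidableEq γ] [DecidableEq δ]
    {B : Type} [Fintype B] (h : κ → B → α × β) {e : α → γ} {e' : β → δ}
    (he : Function.Injective e) (he' : Function.Injective e') :
    Reaches U 0 0 0 (spread h) (spread fun k z => (e (h k z).1, e' (h k z).2)) := by
  refine ⟨_, .localOps _ _ (isIsometry_inj he) (isIsometry_inj he'), ?_⟩
  rw [inj_kronecker_inj, inj_mul_spread]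
  rfl

variable [Fintype κ] [DecidableEq κ] [Fintype γ₂] [Fintype δ₂] {ε ε₂ : ℝ}

theorem Reaches.approx [DecidableEq α] [DecidableEq β] (h : Reaches U n f g ψ φ) :
    Approx U n f g 0 ψ φ := by
  obtain ⟨P, hP, rfl⟩ := h
  exact ⟨P, hP, by rw [sub_self, opNorm_zero]⟩

theorem Approx.trans {N F G : ℕ} {η : ℝ} [DecidableEq γ] [DecidableEq δ]
    (h₁ : Approx U n f g ε ψ φ) (h₂ : Approx U n₂ f₂ g₂ ε₂ φ χ)
    (hU : U ∈ Matrix.unitaryGroup (Fin dA × Fin dB) ℂ)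
    (hN : n + n₂ = N) (hF : f + f₂ = F) (hG : g + g₂ = G)
    (hη : ε + ε₂ = η) :
    Approx U N F G η ψ χ := by
  obtain ⟨P, hP, hP2⟩ := h₁
  obtain ⟨Q, hQ, hQ2⟩ := h₂
  refine ⟨Q * P, hP.comp' hQ hN hF hG, ?_⟩
  have h : Q * P * ψ - χ = Q * (P * ψ - φ) + (Q * φ - χ) := by
    rw [Matrix.mul_sub, Matrix.mul_assoc]; abel
  rw [h, ← hη]
  exact (opNorm_add_le _ _).trans
    (add_le_add (((hQ.isIsometry hU).opNorm_mul_le _).trans hP2) hQ2)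

theorem Approx.trans_local [DecidableEq γ] [DecidableEq δ]
    (h₁ : Approx U n f g ε ψ φ) (h₂ : Reaches U 0 0 0 φ χ)
    (hU : U ∈ Matrix.unitaryGroup (Fin dA × Fin dB) ℂ) : Approx U n f g ε ψ χ :=
  h₁.trans h₂.approx hU rfl rfl rfl (add_zero ε)

theorem Reaches.trans_approx [DecidableEq α] [DecidableEq β] [DecidableEq γ] [DecidableEq δ]
    (h₁ : Reaches U 0 0 0 ψ φ) (h₂ : Approx U n f g ε φ χ)
    (hU : U ∈ Matrix.unitaryGroup (Fin dA × Fin dB) ℂ) : Approx U n f g ε ψ χ :=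
  h₁.approx.trans h₂ hU (zero_add n) (zero_add f) (zero_add g) (zero_add ε)

/-- A guarantee in operator norm persists when the inputs are entangled with spectators; this is
what permits superposed messages and the chaining of protocols. -/
theorem Approx.with_ctx [Fintype κ'] [Fintype α'] [Fintype β'] [DecidableEq α'] [DecidableEq β']
    [DecidableEq κ'] [DecidableEq γ] [DecidableEq δ]
    (h : Approx U n f g ε ψ φ) {T : Matrix (κ × (α' × β')) κ' ℂ} (hT : IsIsometry T) :
    Approx U n f g ε (ctx ψ T) (ctx φ T) := by
  obtain ⟨P, hP, hP2⟩ := h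
  refine ⟨_, hP.ampliate α' β', ?_⟩
  rw [ampliate_mul_ctx, ← ctx_sub]
  exact (opNorm_ctx_le _ hT).trans hP2

end Protocols

/-! ### Isometric embeddings of one space differ by a local isometry. -/

section Extension

variable {α R R₂ : Type} [Fintype R] [DecidableEq R] [Fintype R₂] [DecidableEq R₂]
  [DecidableEq α]

/-- The columns of `J` are orthonormal, so they extend to an orthonormal basis labelled by `R₂` in
which column `a` has the label `e a`; `W` is the change of basis. -/
theorem exists_isIsometry_mul_eq_inj_of_card_eq {J : Matrix R α ℂ} (hJ : IsIsometry J)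
    {e : α → R₂} (he : Function.Injective e) (hc : Fintype.card R = Fintype.card R₂) :
    ∃ W : Matrix R₂ R ℂ, IsIsometry W ∧ W * J = inj e := by
  set v : R₂ → EuclideanSpace ℂ R :=
    Function.extend e (fun a => WithLp.toLp 2 fun r => J r a) 0 with hv
  have hva : ∀ a r, v (e a) r = J r a := fun a r => by rw [hv, he.extend_apply]
  have hin : ∀ x y : EuclideanSpace ℂ R, inner ℂ x y = ∑ r, star (x r) * y r := fun x y => by
    simp [PiLp.inner_apply, mul_comm]
  have ho : Orthonormal ℂ ((Set.range e).domRestrict v) := by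
    rw [orthonormal_iff_ite]
    rintro ⟨_, a, rfl⟩ ⟨_, b, rfl⟩
    have h := congrFun (congrFun hJ a) b
    rw [Matrix.mul_apply, Matrix.one_apply] at h
    rw [hin]
    refine Eq.trans ?_ (h.trans ?_)
    · simp [hva]
    · by_cases hab : a = b
      · subst hab; simp
      · rw [if_neg hab, if_neg fun h => hab (he (Subtype.ext_iff.1 h))]
  obtain ⟨b, hb⟩ := ho.exists_orthonormalBasis_extension_of_card_eq (by simp [hc])
  have hbb := orthonormal_iff_ite.1 b.orthonormal
  -- Orthonormality of `b` says W Wᴴ = 1; equal cardinalities turn this into Wᴴ W = 1.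
  refine ⟨Matrix.of fun i r => star (b i r), ?_, ?_⟩
  · refine (Matrix.mul_eq_one_comm_of_card_eq _ _ _ hc.symm).1 ?_
    ext i j
    rw [Matrix.one_apply, ← hbb i j, hin]
    simp [Matrix.mul_apply]
  · ext i a
    have h := hbb i (e a)
    rw [hb _ ⟨a, rfl⟩, hin] at h
    simp only [hva] at h
    rw [inj_apply, ← h]
    rfl

theorem exists_isIsometry_mul_eq_inj {J : Matrix R α ℂ} (hJ : IsIsometry J)
    {e : α → R₂} (he : Function.Injective e) (hc : Fintype.card R ≤ Fintype.card R₂) :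
    ∃ W : Matrix R₂ R ℂ, IsIsometry W ∧ W * J = inj e := by
  obtain ⟨i⟩ := Function.Embedding.nonempty_of_card_le hc
  obtain ⟨W, hW, h⟩ := exists_isIsometry_mul_eq_inj_of_card_eq
    ((isIsometry_inj i.injective).mul hJ) he rfl
  exact ⟨W * inj i, hW.mul (isIsometry_inj i.injective), by rw [Matrix.mul_assoc, h]⟩

end Extension

/-! ### Fourier matrices and diagonal phases. -/

section Fourier

/-- The character table of ℤ/N. Both properties matter: unimodular entries can be applied as local
phases, and the rescaled matrix can be applied or undone as a local unitary. -/
theorem exists_hadamard (X : Type) [Fintype X] [DecidableEq X] [Nonempty X] :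
    ∃ H : Matrix X X ℂ, (∀ i j, star (H i j) * H i j = 1) ∧ IsIsometry (amp X • H) := by
  obtain ⟨N, hN⟩ : ∃ N, Fintype.card X = N := ⟨_, rfl⟩
  have : NeZero N := ⟨by rw [← hN]; exact Fintype.card_ne_zero⟩
  have e : X ≃ ZMod N := Fintype.equivOfCardEq (by rw [ZMod.card, hN])
  let χ := ZMod.stdAddChar (N := N)
  have hχ : ∀ t, star (χ t) = χ (-t) := fun t => by
    rw [AddChar.map_neg_eq_conj]; rfl
  refine ⟨Matrix.of fun i j => χ (e i * e j), fun i j => ?_, ?_⟩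
  · rw [Matrix.of_apply, hχ, ← AddChar.map_add_eq_mul, neg_add_cancel, AddChar.map_zero_eq_one]
  · ext i j
    simp only [Matrix.mul_apply, Matrix.conjTranspose_apply, Matrix.smul_apply, Matrix.of_apply,
      smul_eq_mul, star_mul, Matrix.one_apply]
    have h1 : ∀ z, star (χ (e z * e i)) * star (amp X) * (amp X * χ (e z * e j)) =
        star (amp X) * amp X * χ (e z * (e j - e i)) := fun z => by
      rw [hχ, show e z * (e j - e i) = -(e z * e i) + e z * e j by ring, AddChar.map_add_eq_mul]
      ring
    simp only [h1]
    rw [← Finset.mul_sum, e.sum_comp (fun z => χ (z * (e j - e i))),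
      AddChar.sum_mulShift _ (ZMod.isPrimitive_stdAddChar N)]
    by_cases hij : i = j
    · have := star_amp_mul_amp X
      simpa [hij, ← hN] using this
    · rw [if_neg (by simpa [sub_eq_zero] using fun h => hij h.symm), if_neg hij]; simp

theorem isIsometry_diagonal {R : Type} [Fintype R] [DecidableEq R] {d : R → ℂ}
    (hd : ∀ r, star (d r) * d r = 1) : IsIsometry (Matrix.diagonal d) := by
  rw [IsIsometry, Matrix.diagonal_conjTranspose, Matrix.diagonal_mul_diagonal,
    ← Matrix.diagonal_one]
  congr 1
  ext r
  exact hd r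

theorem diagonal_kronecker_diagonal_mul_apply {R S κ : Type} [Fintype R] [DecidableEq R]
    [Fintype S] [DecidableEq S] (d : R → ℂ) (d' : S → ℂ) (M : Matrix (R × S) κ ℂ) (r : R × S)
    (k : κ) :
    ((Matrix.diagonal d ⊗ₖ Matrix.diagonal d') * M) r k = d r.1 * d' r.2 * M r k := by
  rw [Matrix.diagonal_kronecker_diagonal, Matrix.diagonal_mul]

end Fourier

/-! ### Attaching maximally entangled states. -/

section Ebits

variable {α β γ δ κ κ' : Type} (E : Type) [Fintype E] [DecidableEq E]

/-- The operator that attaches a maximally entangled state on two copies of `E`. -/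
noncomputable def attach (κ E : Type) [Fintype E] [DecidableEq E] [DecidableEq κ] :
    Matrix (κ × (E × E)) κ ℂ :=
  spread fun k (z : E) => (k, (z, z))

variable [DecidableEq κ]

theorem attach_apply (r : κ × (E × E)) (k : κ) :
    attach κ E r k = if r.1 = k ∧ r.2.1 = r.2.2 then amp E else 0 := by
  rw [attach, spread_apply, Finset.sum_eq_single r.2.1]
  · congr 1
    simp only [Prod.ext_iff, eq_iff_iff]
    grind
  · intro b _ hb
    rw [if_neg]
    rintro rfl
    exact hb rfl
  · simp

theorem ctx_attach_apply [Fintype κ] (ψ : Matrix (α × β) κ ℂ) (r : (α × E) × (β × E)) (k : κ) :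
    ctx ψ (attach κ E) r k = if r.1.2 = r.2.2 then ψ (r.1.1, r.2.1) k * amp E else 0 := by
  rw [ctx_apply, Finset.sum_eq_single k]
  · simp [attach_apply]
  · intro b _ hb
    simp [attach_apply, hb]
  · simp

theorem ctx_attach_mul [Fintype κ] [Fintype κ'] [DecidableEq κ'] (ψ : Matrix (α × β) κ ℂ)
    (M : Matrix κ κ' ℂ) : ctx ψ (attach κ E) * M = ctx (ψ * M) (attach κ' E) := by
  ext r k
  simp only [Matrix.mul_apply, ctx_attach_apply, ite_mul, zero_mul]
  split_ifs with h
  · rw [Finset.sum_mul]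
    exact Finset.sum_congr rfl fun _ _ => by ring
  · simp

variable {dA dB : ℕ} {U : Matrix (Fin dA × Fin dB) (Fin dA × Fin dB) ℂ}
  [Fintype α] [DecidableEq α] [Fintype β] [DecidableEq β] [Fintype κ]

theorem Reaches.attach_unit (ψ : Matrix (α × β) κ ℂ) :
    Reaches U 0 0 0 ψ (ctx ψ (attach κ Unit)) := by
  refine ⟨_, .localOps _ _ (isIsometry_inj (Equiv.prodPUnit α).symm.injective)
    (isIsometry_inj (Equiv.prodPUnit β).symm.injective), ?_⟩
  rw [inj_kronecker_inj_equiv_mul]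
  ext r k
  rw [ctx_attach_apply, if_pos rfl, amp_of_unique, mul_one]
  rfl

theorem Reaches.attach_prod (E₂ : Type) [Fintype E₂] [DecidableEq E₂] (ψ : Matrix (α × β) κ ℂ) :
    Reaches U 0 0 0 (ctx (ctx ψ (attach κ E)) (attach κ E₂))
      (ctx ψ (attach κ (E × E₂))) := by
  refine ⟨_, .localOps _ _ (isIsometry_inj (Equiv.prodAssoc α E E₂).injective)
    (isIsometry_inj (Equiv.prodAssoc β E E₂).injective), ?_⟩
  rw [inj_kronecker_inj_equiv_mul]
  ext ⟨⟨a, e, e₂⟩, ⟨b, e', e₂'⟩⟩ k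
  simp only [Matrix.submatrix_apply, ctx_attach_apply, Prod.map,
    Equiv.prodAssoc_symm_apply, amp_prod, Prod.mk.injEq, ite_and, id, ite_mul, zero_mul]
  split_ifs <;> ring

end Ebits

/-! ### Running protocols backwards. -/

section Reversal

variable {dA dB : ℕ}

/-- Every embedding of the final registers of `P` into registers of suitable dimensions can be
taken back, by a protocol for the inverse gate, to an embedding of the initial registers; every
cobit of `P` is replaced by a cobit in the opposite direction and yields an ebit. -/
def Reversible (U : Matrix (Fin dA × Fin dB) (Fin dA × Fin dB) ℂ) (n f g : ℕ)
    {α β γ δ : Type} [Fintype α] [DecidableEq α] [Fintype β] [DecidableEq β] [Fintype γ]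
    [DecidableEq γ] [Fintype δ] [DecidableEq δ] (P : Matrix (γ × δ) (α × β) ℂ) : Prop :=
  ∀ (x y : ℕ) (R S : Type) [Fintype R] [DecidableEq R] [Fintype S] [DecidableEq S]
    (J : Matrix R γ ℂ) (K : Matrix S δ ℂ), IsIsometry J → IsIsometry K →
    Fintype.card R = 2 ^ g * (dA * x) → Fintype.card S = 2 ^ f * (dB * y) →
    ∃ (R' S' E : Type) (_ : Fintype R') (_ : DecidableEq R') (_ : Fintype S') (_ : DecidableEq S')
      (_ : Fintype E) (_ : DecidableEq E) (J' : Matrix R' α ℂ) (K' : Matrix S' β ℂ),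
      IsIsometry J' ∧ IsIsometry K' ∧ Fintype.card R' = dA * x ∧ Fintype.card S' = dB * y ∧
      Fintype.card E = 2 ^ (f + g) ∧
      Reaches Uᴴ n g f ((J ⊗ₖ K) * P) (ctx (J' ⊗ₖ K') (attach (α × β) E))

variable {U : Matrix (Fin dA × Fin dB) (Fin dA × Fin dB) ℂ}
  {α β γ δ : Type} [Fintype α] [DecidableEq α] [Fintype β] [DecidableEq β] [Fintype γ]
    [DecidableEq γ] [Fintype δ] [DecidableEq δ]

theorem reversible_localOps {V : Matrix γ α ℂ} {W : Matrix δ β ℂ}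
    (hV : IsIsometry V) (hW : IsIsometry W) : Reversible U 0 0 0 (V ⊗ₖ W) := by
  intro x y R S _ _ _ _ J K hJ hK hR hS
  refine ⟨R, S, Unit, inferInstance, inferInstance, inferInstance, inferInstance, inferInstance,
    inferInstance, J * V, K * W, hJ.mul hV, hK.mul hW, by simpa using hR, by simpa using hS,
    by simp, ?_⟩
  rw [← Matrix.mul_kronecker_mul]
  exact Reaches.attach_unit _

theorem Reversible.comp {n n₂ f f₂ g g₂ : ℕ} {γ₂ δ₂ : Type} [Fintype γ₂] [DecidableEq γ₂]
    [Fintype δ₂] [DecidableEq δ₂] {P : Matrix (γ × δ) (α × β) ℂ} {Q : Matrix (γ₂ × δ₂) (γ × δ) ℂ}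
    (hP : Reversible U n f g P) (hQ : Reversible U n₂ f₂ g₂ Q) :
    Reversible U (n + n₂) (f + f₂) (g + g₂) (Q * P) := by
  intro x y R S _ _ _ _ J K hJ hK hR hS
  obtain ⟨R₁, S₁, E₂, _, _, _, _, _, _, J₁, K₁, hJ₁, hK₁, hR₁, hS₁, hE₂, h₂⟩ :=
    -- Undoing `Q` must leave the dimensions that undoing `P` expects, hence the factors 2 ^ g and 2
    -- ^ f.
    hQ (2 ^ g * x) (2 ^ f * y) R S J K hJ hK (by rw [hR]; ring) (by rw [hS]; ring)
  obtain ⟨R', S', E₁, _, _, _, _, _, _, J', K', hJ', hK', hR', hS', hE₁, h₁⟩ :=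
    hP x y R₁ S₁ J₁ K₁ hJ₁ hK₁ (by rw [hR₁]; ring) (by rw [hS₁]; ring)
  refine ⟨R', S', E₁ × E₂, inferInstance, inferInstance, inferInstance, inferInstance,
    inferInstance, inferInstance, J', K', hJ', hK', hR', hS', ?_, ?_⟩
  · rw [Fintype.card_prod, hE₁, hE₂, ← pow_add]
    congr 1; omega
  · rw [← Matrix.mul_assoc]
    have h3 := h₂.mul_right P
    rw [ctx_attach_mul] at h3
    have h4 := h3.trans (h₁.with_ctx (attach (α × β) E₂)) (add_comm _ n) (add_comm _ g)
      (add_comm _ f)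
    exact h4.trans_local (Reaches.attach_prod _ _ _)

theorem inj_kronecker_mul_gateOp {X Y : Type} [Fintype X] [DecidableEq X]
    [Fintype Y] [DecidableEq Y] (i : α → X) (j : β → Y) :
    (inj (Prod.map (id : Fin dA → Fin dA) i) ⊗ₖ inj (Prod.map (id : Fin dB → Fin dB) j)) *
        gateOp U α β =
      gateOp U X Y *
        (inj (Prod.map (id : Fin dA → Fin dA) i) ⊗ₖ inj (Prod.map (id : Fin dB → Fin dB) j)) := by
  rw [inj_kronecker_inj, mul_inj, gateOp_eq_ampliate, gateOp_eq_ampliate]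
  ext ⟨⟨a, x⟩, ⟨b, y⟩⟩ ⟨⟨a', x'⟩, ⟨b', y'⟩⟩
  rw [Matrix.mul_apply, Finset.sum_eq_single ((a, x'), (b, y'))]
  · simp only [inj_apply, ampliate_apply, Matrix.submatrix_apply, Prod.map, id, Matrix.one_apply,
      Prod.mk.injEq, true_and]
    split_ifs <;> simp
  · rintro ⟨⟨a₁, x₁⟩, ⟨b₁, y₁⟩⟩ - hne
    simp only [inj_apply, ampliate_apply, Prod.map, id, Matrix.one_apply, Prod.mk.injEq]
    split_ifs with h1 h2 <;> simp_all
  · simp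

theorem gateOp_conjTranspose_mul_gateOp (hU : U ∈ Matrix.unitaryGroup (Fin dA × Fin dB) ℂ) :
    gateOp Uᴴ α β * gateOp U α β = 1 := by
  have h : Uᴴ * U = 1 := Matrix.mem_unitaryGroup_iff'.1 hU
  rw [gateOp_eq_ampliate, gateOp_eq_ampliate, ampliate_mul_ampliate, h, ampliate,
    Matrix.one_kronecker_one, Matrix.submatrix_one_equiv]

/-- As `dA` divides the dimension of Alice's register, her embedding can be rotated into one that
leaves the gate's input alone and embeds only the idle register, and likewise for Bob. Such
embeddings commute with the gate, which the inverse gate then cancels. -/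
theorem reversible_gate (hU : U ∈ Matrix.unitaryGroup (Fin dA × Fin dB) ℂ) (hA : 0 < dA)
    (hB : 0 < dB) : Reversible U 1 0 0 (gateOp U α β) := by
  intro x y R S _ _ _ _ J K hJ hK hR hS
  have hJc := hJ.card_le
  have hKc := hK.card_le
  rw [Fintype.card_prod, Fintype.card_fin, hR, pow_zero, one_mul] at hJc
  rw [Fintype.card_prod, Fintype.card_fin, hS, pow_zero, one_mul] at hKc
  obtain ⟨i⟩ : Nonempty (α ↪ Fin x) := Function.Embedding.nonempty_of_card_le
    (by simpa using Nat.le_of_mul_le_mul_left hJc hA)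
  obtain ⟨j⟩ : Nonempty (β ↪ Fin y) := Function.Embedding.nonempty_of_card_le
    (by simpa using Nat.le_of_mul_le_mul_left hKc hB)
  have hi := (Function.injective_id (α := Fin dA)).prodMap i.injective
  have hj := (Function.injective_id (α := Fin dB)).prodMap j.injective
  obtain ⟨V, hV, hVJ⟩ := exists_isIsometry_mul_eq_inj hJ hi (by simp [hR])
  obtain ⟨W, hW, hWK⟩ := exists_isIsometry_mul_eq_inj hK hj (by simp [hS])
  refine ⟨Fin dA × Fin x, Fin dB × Fin y, Unit, inferInstance, inferInstance, inferInstance,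
    inferInstance, inferInstance, inferInstance, _, _, isIsometry_inj hi, isIsometry_inj hj,
    by simp, by simp, by simp, ?_⟩
  have h1 := Reaches.localOps (U := Uᴴ) ((J ⊗ₖ K) * gateOp U α β) hV hW
  rw [← Matrix.mul_assoc, ← Matrix.mul_kronecker_mul, hVJ, hWK, inj_kronecker_mul_gateOp] at h1
  refine (h1.local_trans (⟨_, .gate _ _, ?_⟩ : Reaches Uᴴ 1 0 0 _ _)).trans_local
    (Reaches.attach_unit _)
  rw [← Matrix.mul_assoc, gateOp_conjTranspose_mul_gateOp hU, Matrix.one_mul]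

/-- Conjugate entries of `H` on the range of `e`, and 1 elsewhere so that the diagonal operator
stays unitary on the whole register. -/
theorem exists_phase {ξ X R : Type} [Fintype X] [DecidableEq X] {H : Matrix X X ℂ}
    (hH : ∀ i j, star (H i j) * H i j = 1) {e : X × ξ → R} (he : Function.Injective e) :
    ∃ d : X × R → ℂ, (∀ r, star (d r) * d r = 1) ∧ ∀ z s, d (z, e s) * H z s.1 = 1 := by
  refine ⟨fun p => Function.extend e (fun s => star (H p.1 s.1)) 1 p.2, fun r => ?_,
    fun z s => ?_⟩
  · beta_reduce
    by_cases h : ∃ a, e a = r.2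
    · obtain ⟨a, ha⟩ := h
      rw [← ha, he.extend_apply, star_star, mul_comm]
      exact hH _ _
    · rw [Function.extend_apply' _ _ _ h]; simp
  · simp only [he.extend_apply, hH]

/-- Bob's Hadamard transform turns |p⟩|p⟩ into |p⟩ ∑_w H w p |w⟩ up to normalisation. After a cobit
from Bob, Alice holds both w and p and cancels H w p, which leaves |p⟩ and the ebit ∑_w |w⟩|w⟩. The
qubit that the original cobit gave to Bob becomes his half of this ebit. -/
theorem reversible_cobitAB : Reversible U 0 1 0 (cobitAB α β) := by
  intro x y R S _ _ _ _ J K hJ hK hR hS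
  have hJc := hJ.card_le
  have hKc := hK.card_le
  rw [Fintype.card_prod, Fintype.card_bool, hS, pow_one] at hKc
  obtain ⟨i⟩ := Function.Embedding.nonempty_of_card_le hJc
  obtain ⟨j⟩ : Nonempty (β ↪ Fin (dB * y)) := Function.Embedding.nonempty_of_card_le
    (by rw [Fintype.card_fin]; omega)
  have hj := (Function.injective_id (α := Bool)).prodMap j.injective
  obtain ⟨V, hV, hVJ⟩ := exists_isIsometry_mul_eq_inj hJ i.injective le_rfl
  obtain ⟨W, hW, hWK⟩ := exists_isIsometry_mul_eq_inj hK hj (by simp [hS])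
  obtain ⟨H, hH, hHi⟩ := exists_hadamard Bool
  obtain ⟨d, hd, hdH⟩ := exists_phase hH i.injective
  refine ⟨R, Fin (dB * y), Bool, inferInstance, inferInstance, inferInstance,
    inferInstance, inferInstance, inferInstance, _, _, isIsometry_inj i.injective,
    isIsometry_inj j.injective, by simp [hR], by simp, by simp, ?_⟩
  rw [cobitAB_eq_inj]
  have h1 := Reaches.localOps (U := Uᴴ) ((J ⊗ₖ K) *
    inj fun s : (Bool × α) × β => (s.1, (s.1.1, s.2))) hV hW
  rw [← Matrix.mul_assoc, ← Matrix.mul_kronecker_mul, hVJ, hWK, inj_kronecker_inj,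
    inj_mul_inj] at h1
  have h2 := h1.trans_local (Reaches.localOps _ (isIsometry_one (α := R))
    (hHi.kronecker (isIsometry_one (α := Fin (dB * y)))))
  have h3 := h2.local_trans (⟨_, .sendBA R (Fin (dB * y)), rfl⟩ : Reaches Uᴴ 0 0 1 _ _)
  have h4 := h3.trans_local (Reaches.localOps _ (isIsometry_diagonal hd) (isIsometry_diagonal
    (R := Bool × Fin (dB * y)) (d := fun _ => 1) (by simp)))
  have h5 := h4.trans_local (Reaches.localOps _ (isIsometry_inj (Equiv.prodComm Bool R).injective)
    (isIsometry_inj (Equiv.prodComm Bool (Fin (dB * y))).injective))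
  convert h5 using 1
  rw [inj_kronecker_inj_equiv_mul, cobitBA_eq_inj, mul_inj]
  ext ⟨⟨r, z⟩, ⟨s, w⟩⟩ ⟨⟨p, a⟩, b⟩
  simp only [Matrix.submatrix_apply, id, ctx_attach_apply, diagonal_kronecker_diagonal_mul_apply]
  rw [Matrix.mul_apply, Finset.sum_eq_single (r, (w, s))]
  -- Alice's phase cancels the Hadamard coefficient, so only the amplitude of the ebit remains.
  · have h6 : d (w, i (p, a)) * (amp Bool * H w p) = amp Bool := by
      linear_combination amp Bool * hdH w (p, a)
    simp only [inj_apply, Matrix.kroneckerMap_apply, Matrix.one_apply, Matrix.submatrix_apply,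
      Prod.map, Function.comp, id, Matrix.smul_apply, smul_eq_mul, Equiv.prodComm_symm,
      Equiv.prodComm_apply, Prod.swap, Prod.mk.injEq, and_true]
    split_ifs with h1 h2 h3 <;> simp_all
  · rintro ⟨r', w', s'⟩ - hne
    rw [inj_apply, if_neg, zero_mul]
    intro h
    simp at h
    simp_all
  · simp

theorem reversible_cobitBA : Reversible U 0 0 1 (cobitBA α β) := by
  intro x y R S _ _ _ _ J K hJ hK hR hS
  have hJc := hJ.card_le
  have hKc := hK.card_le
  rw [Fintype.card_prod, Fintype.card_bool, hR, pow_one] at hJc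
  obtain ⟨i⟩ : Nonempty (α ↪ Fin (dA * x)) := Function.Embedding.nonempty_of_card_le
    (by rw [Fintype.card_fin]; omega)
  obtain ⟨j⟩ := Function.Embedding.nonempty_of_card_le hKc
  have hi := (Function.injective_id (α := Bool)).prodMap i.injective
  obtain ⟨V, hV, hVJ⟩ := exists_isIsometry_mul_eq_inj hJ hi (by simp [hR])
  obtain ⟨W, hW, hWK⟩ := exists_isIsometry_mul_eq_inj hK j.injective le_rfl
  obtain ⟨H, hH, hHi⟩ := exists_hadamard Bool
  obtain ⟨d, hd, hdH⟩ := exists_phase hH j.injective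
  refine ⟨Fin (dA * x), S, Bool, inferInstance, inferInstance, inferInstance,
    inferInstance, inferInstance, inferInstance, _, _, isIsometry_inj i.injective,
    isIsometry_inj j.injective, by simp, by simp [hS], by simp, ?_⟩
  rw [cobitBA_eq_inj]
  have h1 := Reaches.localOps (U := Uᴴ) ((J ⊗ₖ K) *
    inj fun s : α × (Bool × β) => ((s.2.1, s.1), s.2)) hV hW
  rw [← Matrix.mul_assoc, ← Matrix.mul_kronecker_mul, hVJ, hWK, inj_kronecker_inj,
    inj_mul_inj] at h1
  have h2 := h1.trans_local (Reaches.localOps _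
    (hHi.kronecker (isIsometry_one (α := Fin (dA * x)))) (isIsometry_one (α := S)))
  have h3 := h2.local_trans (⟨_, .sendAB (Fin (dA * x)) S, rfl⟩ : Reaches Uᴴ 0 1 0 _ _)
  have h4 := h3.trans_local (Reaches.localOps _ (isIsometry_diagonal
    (R := Bool × Fin (dA * x)) (d := fun _ => 1) (by simp)) (isIsometry_diagonal hd))
  have h5 := h4.trans_local (Reaches.localOps _
    (isIsometry_inj (Equiv.prodComm Bool (Fin (dA * x))).injective)
    (isIsometry_inj (Equiv.prodComm Bool S).injective))
  convert h5 using 1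
  rw [inj_kronecker_inj_equiv_mul, cobitAB_eq_inj, mul_inj]
  ext ⟨⟨r, z⟩, ⟨s, w⟩⟩ ⟨a, ⟨p, b⟩⟩
  simp only [Matrix.submatrix_apply, id, ctx_attach_apply, diagonal_kronecker_diagonal_mul_apply]
  rw [Matrix.mul_apply, Finset.sum_eq_single ((z, r), s)]
  · have h6 : d (z, j (p, b)) * (amp Bool * H z p) = amp Bool := by
      linear_combination amp Bool * hdH z (p, b)
    simp only [inj_apply, Matrix.kroneckerMap_apply, Matrix.one_apply, Matrix.submatrix_apply,
      Prod.map, Function.comp, id, Matrix.smul_apply, smul_eq_mul, Equiv.prodComm_symm,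
      Equiv.prodComm_apply, Prod.swap, Prod.mk.injEq, true_and, and_true]
    rcases eq_or_ne z w with rfl | h7
    · rcases eq_or_ne r (i a) with rfl | h8
      · rcases eq_or_ne s (j (p, b)) with rfl | h9
        · simp [h6]
        · simp [h9]
      · simp [h8]
    · simp [h7, h7.symm]
  · rintro ⟨⟨z', r'⟩, s'⟩ - hne
    rw [inj_apply, if_neg, zero_mul]
    intro h
    simp at h
    simp_all
  · simp

theorem Protocol.reversible (hU : U ∈ Matrix.unitaryGroup (Fin dA × Fin dB) ℂ) (hA : 0 < dA)
    (hB : 0 < dB) {n f g : ℕ} {P : Matrix (γ × δ) (α × β) ℂ}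
    (hP : Protocol U n f g α β γ δ P) : Reversible U n f g P := by
  classical
  have key : ∀ {n f g : ℕ} {α β γ δ : Type} {P : Matrix (γ × δ) (α × β) ℂ},
      Protocol U n f g α β γ δ P → ∃ (_ : Fintype α) (_ : DecidableEq α) (_ : Fintype β)
        (_ : DecidableEq β) (_ : Fintype γ) (_ : DecidableEq γ) (_ : Fintype δ)
        (_ : DecidableEq δ), Reversible U n f g P := by
    intro n f g α β γ δ P hP
    induction hP with
    | localOps V W hV hW =>
      exact ⟨_, _, _, _, _, Classical.decEq _, _, Classical.decEq _, reversible_localOps hV hW⟩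
    | gate α β =>
      exact ⟨_, _, _, _, _, _, _, _, reversible_gate hU hA hB⟩
    | sendAB α β => exact ⟨_, _, _, _, _, _, _, _, reversible_cobitAB⟩
    | sendBA α β => exact ⟨_, _, _, _, _, _, _, _, reversible_cobitBA⟩
    | @comp _ _ _ _ _ _ _ _ _ _ _ _ j₁ j₂ _ _ _ _ ih1 ih2 =>
      obtain ⟨i1, i2, i3, i4, i5, i6, i7, i8, h1⟩ := ih1
      obtain ⟨k1, k2, k3, k4, k5, k6, k7, k8, h2⟩ := ih2
      obtain rfl := Subsingleton.elim i5 j₁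
      obtain rfl := Subsingleton.elim i7 j₂
      obtain rfl := Subsingleton.elim k1 i5
      obtain rfl := Subsingleton.elim k2 i6
      obtain rfl := Subsingleton.elim k3 i7
      obtain rfl := Subsingleton.elim k4 i8
      exact ⟨_, _, _, _, _, _, _, _, h1.comp h2⟩
  obtain ⟨_, _, _, _, _, _, _, _, h⟩ := key hP
  convert h

end Reversal

/-! ### Contexts applied to superpositions of basis states. -/

section Spread

variable {α β κ κ' α' β' τ B S : Type} [Fintype B] [Fintype S]

theorem inj_eq_spread {γ : Type} [DecidableEq γ] (e : κ → γ) :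
    inj e = spread fun k (_ : Unit) => e k := by
  ext r k
  simp [inj_apply, spread_apply, amp_of_unique]

theorem ctx_inj [Fintype κ] [Fintype α'] [Fintype β'] [DecidableEq α'] [DecidableEq β']
    [DecidableEq κ] [DecidableEq α] [DecidableEq β] (h : κ → B → α × β)
    (t : κ' → κ × (α' × β')) :
    ctx (spread h) (inj t) = spread fun k' (z : B) =>
      (((h (t k').1 z).1, (t k').2.1), ((h (t k').1 z).2, (t k').2.2)) := by
  rw [inj_eq_spread, ctx_spread, spread_congr_equiv _ (Equiv.punitProd B).symm]
  rfl

theorem ctx_one [Fintype α'] [Fintype β'] [DecidableEq α'] [DecidableEq β']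
    [Fintype α] [Fintype β] [DecidableEq α] [DecidableEq β]
    (t : κ' → B → (α × β) × (α' × β')) :
    ctx 1 (spread t) = spread fun k' z =>
      (((t k' z).1.1, (t k' z).2.1), ((t k' z).1.2, (t k' z).2.2)) := by
  ext ⟨⟨a, a'⟩, ⟨b, b'⟩⟩ k
  rw [ctx, Matrix.one_kronecker_one, Matrix.one_mul, Matrix.submatrix_apply, spread_apply,
    spread_apply]
  refine Finset.sum_congr rfl fun z _ => ?_
  congr 1
  simp only [Equiv.prodProdProdComm_apply, Prod.ext_iff, eq_iff_iff, id]
  tauto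

theorem kronecker_one_mul_spread [Fintype κ] [Fintype κ'] [Fintype τ] [DecidableEq κ]
    [DecidableEq κ'] [DecidableEq τ] (M : Matrix κ κ' ℂ) (w : B → τ) :
    (M ⊗ₖ (1 : Matrix τ τ ℂ)) * (spread fun k z => (k, w z) : Matrix (κ' × τ) κ' ℂ) =
      (spread fun k z => (k, w z) : Matrix (κ × τ) κ ℂ) * M := by
  ext ⟨k, t⟩ k'
  rw [Matrix.mul_apply, Matrix.mul_apply, Finset.sum_eq_single (k', t), Finset.sum_eq_single k]
  · simp [spread_apply, mul_comm]
  · intro b _ hb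
    simp [spread_apply, hb.symm]
  · simp
  · rintro ⟨k₁, t₁⟩ - hb
    by_cases h : t = t₁
    · subst h
      have hk : k₁ ≠ k' := fun h => hb (by rw [h])
      simp [spread_apply, hk]
    · simp [h]
  · simp

end Spread

/-! ### Inputs and outputs of clean protocols; chaining and reversing them. -/

section Resources

variable (X Y A B : Type) {K L : Type} [Fintype A] [Fintype B] [DecidableEq X] [DecidableEq Y]
  [DecidableEq A] [DecidableEq B] [DecidableEq K] [DecidableEq L]

/-- The isometry `|x⟩^A |y⟩^B ↦ |x⟩^A |y⟩^B Φ`, `Φ` maximally entangled on two copies of `A`. -/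
noncomputable def source : Matrix ((X × A) × (Y × A)) (X × Y) ℂ :=
  spread fun s z => ((s.1, z), (s.2, z))

/-- The isometry `|x⟩^A |y⟩^B ↦ |x,y⟩^A |x,y⟩^B Φ |k₀⟩^A |l₀⟩^B`. -/
noncomputable def goal (k₀ : K) (l₀ : L) :
    Matrix ((X × Y × B × K) × (X × Y × B × L)) (X × Y) ℂ :=
  spread fun s z => ((s.1, s.2, z, k₀), (s.1, s.2, z, l₀))

variable {X Y A B}

theorem goal_apply (k₀ : K) (l₀ : L) (r : (X × Y × B × K) × (X × Y × B × L)) (s : X × Y) :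
    goal X Y B k₀ l₀ r s = if r.1.1 = s.1 ∧ r.1.2.1 = s.2 ∧ r.2.1 = s.1 ∧ r.2.2.1 = s.2 ∧
      r.1.2.2.1 = r.2.2.2.1 ∧ r.1.2.2.2 = k₀ ∧ r.2.2.2.2 = l₀ then amp B else 0 := by
  rw [goal, spread_apply, Finset.sum_eq_single r.1.2.2.1]
  · congr 1
    simp only [Prod.ext_iff, eq_iff_iff]
    grind
  · intro b _ hb
    rw [if_neg]
    rintro rfl
    exact hb rfl
  · simp

end Resources

section Regrouping

variable {X Y X' Y' K L S : Type}

/-- Regrouping of the inputs of two protocols. -/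
def swapInputs (s : (X × X') × (Y × Y')) : (X × Y) × (X' × Y') :=
  ((s.1.1, s.2.1), (s.1.2, s.2.2))

theorem injective_swapInputs : Function.Injective (swapInputs (X := X) (X' := X') (Y := Y)
    (Y' := Y')) :=
  (Equiv.prodProdProdComm X X' Y Y').injective

/-- The output of a first protocol, next to the inputs of a second one. -/
def nextInputs (k₀ : K) (l₀ : L) (s : (X × X') × (Y × Y')) (z : S) :
    (X' × Y') × ((X × Y × S × K) × (X × Y × S × L)) :=
  ((s.1.2, s.2.2), ((s.1.1, s.2.1, z, k₀), (s.1.1, s.2.1, z, l₀)))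

theorem injective_nextInputs (k₀ : K) (l₀ : L) : Function.Injective
    fun s : ((X × X') × (Y × Y')) × S => nextInputs k₀ l₀ s.1 s.2 := by
  rintro ⟨⟨⟨x, x'⟩, ⟨y, y'⟩⟩, z⟩ ⟨⟨⟨x₁, x₁'⟩, ⟨y₁, y₁'⟩⟩, z₁⟩ h
  simp only [nextInputs, Prod.mk.injEq] at h ⊢
  tauto

end Regrouping

section Transformations

set_option synthInstance.maxSize 2000

variable {dA dB : ℕ} {U : Matrix (Fin dA × Fin dB) (Fin dA × Fin dB) ℂ} {n f g n₂ f₂ g₂ : ℕ}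
  {ε ε₂ : ℝ}

theorem Approx.mul_right {α β γ δ κ κ' : Type} [Fintype α] [Fintype β] [Fintype γ] [Fintype δ]
    [Fintype κ] [DecidableEq κ] [Fintype κ'] [DecidableEq κ'] {ψ : Matrix (α × β) κ ℂ}
    {φ : Matrix (γ × δ) κ ℂ} (h : Approx U n f g ε ψ φ) {T : Matrix κ κ' ℂ} (hT : IsIsometry T) :
    Approx U n f g ε (ψ * T) (φ * T) := by
  obtain ⟨P, hP, hP2⟩ := h
  refine ⟨P, hP, ?_⟩
  rw [← Matrix.mul_assoc, ← Matrix.sub_mul]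
  exact (opNorm_mul_le_of_isIsometry _ hT).trans hP2

variable {X Y A B K L X' Y' A' B' K' L' : Type}
  [Fintype X] [DecidableEq X] [Fintype Y] [DecidableEq Y] [Fintype A] [DecidableEq A]
  [Fintype B] [DecidableEq B] [Fintype K] [DecidableEq K] [Fintype L] [DecidableEq L]
  [Fintype X'] [DecidableEq X'] [Fintype Y'] [DecidableEq Y'] [Fintype A'] [DecidableEq A']
  [Fintype B'] [DecidableEq B'] [Fintype K'] [DecidableEq K'] [Fintype L'] [DecidableEq L']
  {k₀ : K} {l₀ : L} {k₀' : K'} {l₀' : L'}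

theorem Approx.relabel (hU : U ∈ Matrix.unitaryGroup (Fin dA × Fin dB) ℂ)
    (h : Approx U n f g ε (source X Y A) (goal X Y B k₀ l₀)) (eX : X' ≃ X) (eY : Y' ≃ Y)
    (eA : A' ≃ A) (eB : B' ≃ B) {i : K → K'} (hi : Function.Injective i) {j : L → L'}
    (hj : Function.Injective j) :
    Approx U n f g ε (source X' Y' A') (goal X' Y' B' (i k₀) (j l₀)) := by
  have h1 : Reaches U 0 0 0 (source X' Y' A') (source X Y A * inj (Prod.map eX eY)) := by
    rw [source, source, spread_mul_inj, spread_congr_equiv _ eA]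
    exact Reaches.spread _ (eX.injective.prodMap eA.injective) (eY.injective.prodMap eA.injective)
  have h2 : Reaches U 0 0 0 (goal X Y B k₀ l₀ * inj (Prod.map eX eY))
      (goal X' Y' B' (i k₀) (j l₀)) := by
    rw [goal, goal, spread_mul_inj, spread_congr_equiv _ eB]
    convert Reaches.spread _
      (eX.symm.injective.prodMap (eY.symm.injective.prodMap (eB.symm.injective.prodMap hi)))
      (eX.symm.injective.prodMap (eY.symm.injective.prodMap (eB.symm.injective.prodMap hj))) using 1
    simp
  exact (h1.trans_approx (h.mul_right (isIsometry_inj (eX.injective.prodMap eY.injective)))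
    hU).trans_local h2 hU

theorem exists_injective_apply_eq {K K' : Type} [Fintype K] [Fintype K'] [DecidableEq K']
    (hc : Fintype.card K ≤ Fintype.card K') (k₀ : K) (k₀' : K') :
    ∃ i : K → K', Function.Injective i ∧ i k₀ = k₀' := by
  obtain ⟨e⟩ := Function.Embedding.nonempty_of_card_le hc
  exact ⟨Equiv.swap (e k₀) k₀' ∘ e, (Equiv.injective _).comp e.injective,
    Equiv.swap_apply_left _ _⟩

theorem Approx.to_bits (hU : U ∈ Matrix.unitaryGroup (Fin dA × Fin dB) ℂ)
    (h : Approx U n f g ε (source X Y A) (goal X Y B k₀ l₀)) {p q a b k l : ℕ}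
    (hX : Fintype.card X = 2 ^ p) (hY : Fintype.card Y = 2 ^ q) (hA : Fintype.card A = 2 ^ a)
    (hB : Fintype.card B = 2 ^ b) (hK : Fintype.card K ≤ 2 ^ k) (hL : Fintype.card L ≤ 2 ^ l) :
    Approx U n f g ε (supply p q a) (target p q b k l) := by
  have hb : ∀ m, Fintype.card (Bits m) = 2 ^ m := fun m => by simp
  obtain ⟨i, hi, hi0⟩ := exists_injective_apply_eq (hK.trans_eq (hb k).symm) k₀ fun _ => false
  obtain ⟨j, hj, hj0⟩ := exists_injective_apply_eq (hL.trans_eq (hb l).symm) l₀ fun _ => false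
  rw [supply_eq_spread, target_eq_spread]
  have := h.relabel hU (Fintype.equivOfCardEq ((hb p).trans hX.symm))
    (Fintype.equivOfCardEq ((hb q).trans hY.symm)) (Fintype.equivOfCardEq ((hb a).trans hA.symm))
    (Fintype.equivOfCardEq ((hb b).trans hB.symm)) hi hj
  rw [hi0, hj0] at this
  exact this

section Sequential

variable {S : Type} [Fintype S] [DecidableEq S]

theorem reaches_ctx_source : Reaches U 0 0 0 (source (X × X') (Y × Y') A)
    (ctx (source X Y A) (inj swapInputs)) := by
  rw [source, source, ctx_inj]
  exact Reaches.spread _ (e := fun s : (X × X') × A => ((s.1.1, s.2), s.1.2))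
    (e' := fun s : (Y × Y') × A => ((s.1.1, s.2), s.1.2))
    (by rintro ⟨⟨a, b⟩, c⟩ ⟨⟨a', b'⟩, c'⟩ h; simp only [Prod.mk.injEq] at h ⊢; tauto)
    (by rintro ⟨⟨a, b⟩, c⟩ ⟨⟨a', b'⟩, c'⟩ h; simp only [Prod.mk.injEq] at h ⊢; tauto)

theorem reaches_ctx_nextInputs :
    Reaches U 0 0 0 (ctx (goal X Y (A' × S) k₀ l₀) (inj (swapInputs (X' := X') (Y' := Y'))))
      (ctx (source X' Y' A') (spread (nextInputs (S := S) k₀ l₀))) := by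
  have h : ∀ {X Y X' K : Type}, Function.Injective fun s : (X × Y × (A' × S) × K) × X' =>
      ((s.2, s.1.2.2.1.1), (s.1.1, s.1.2.1, s.1.2.2.1.2, s.1.2.2.2)) := by
    rintro X Y X' K ⟨⟨a, b, ⟨c, d⟩, e⟩, f⟩ ⟨⟨a', b', ⟨c', d'⟩, e'⟩, f'⟩ h
    simp only [Prod.mk.injEq] at h ⊢
    tauto
  rw [source, goal, ctx_inj, ctx_spread, spread_congr_equiv _ (Equiv.prodComm S A')]
  exact Reaches.spread _ h h

theorem reaches_goal_prod :
    Reaches U 0 0 0 (ctx (goal X' Y' B' k₀' l₀') (spread (nextInputs (S := S) k₀ l₀)))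
      (goal (X × X') (Y × Y') (S × B') (k₀, k₀') (l₀, l₀')) := by
  have h : ∀ {K K' : Type}, Function.Injective fun s : (X' × Y' × B' × K') × (X × Y × S × K) =>
      ((s.2.1, s.1.1), (s.2.2.1, s.1.2.1), (s.2.2.2.1, s.1.2.2.1), (s.2.2.2.2, s.1.2.2.2)) := by
    rintro K K' ⟨⟨a, b, c, d⟩, e, f, g, i⟩ ⟨⟨a', b', c', d'⟩, e', f', g', i'⟩ h
    simp only [Prod.mk.injEq] at h ⊢
    tauto
  rw [goal, goal, ctx_spread]
  exact Reaches.spread _ h h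

/-- The ebits made by the first protocol split into `A'`, which feeds the second, and a surplus `S`.
Each protocol runs with the other's inputs or outputs as spectators, so the errors add. -/
theorem Approx.sequential (hU : U ∈ Matrix.unitaryGroup (Fin dA × Fin dB) ℂ) [Nonempty S]
    (h₁ : Approx U n f g ε (source X Y A) (goal X Y (A' × S) k₀ l₀))
    (h₂ : Approx U n₂ f₂ g₂ ε₂ (source X' Y' A') (goal X' Y' B' k₀' l₀')) :
    Approx U (n + n₂) (f + f₂) (g + g₂) (ε + ε₂) (source (X × X') (Y × Y') A)
      (goal (X × X') (Y × Y') (S × B') (k₀, k₀') (l₀, l₀')) := by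
  have h₃ := reaches_ctx_source.trans_approx
    (h₁.with_ctx (isIsometry_inj (injective_swapInputs (X' := X') (Y' := Y')))) hU
  have h₄ := h₂.with_ctx (isIsometry_spread (injective_nextInputs (X := X) (X' := X') (Y := Y)
    (Y' := Y') (S := S) k₀ l₀))
  exact ((h₃.trans_local reaches_ctx_nextInputs hU).trans h₄ hU rfl rfl rfl rfl).trans_local
    reaches_goal_prod hU

end Sequential

/-- Undoing `P` is exact on its range, and protocols are isometries, so starting from the ideal
output instead of the actual one costs at most ε. The bounds `hK'` and `hL'` leave room to rotate
what remains into inputs, old ebits and blanks. -/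
theorem Approx.reverse (hU : U ∈ Matrix.unitaryGroup (Fin dA × Fin dB) ℂ) (hdA : 0 < dA)
    (hdB : 0 < dB) (h : Approx U n f g ε (source X Y A) (goal X Y B k₀ l₀)) {c d : ℕ}
    (hc : Fintype.card (X × Y × B × K) = 2 ^ g * c) (hd : Fintype.card (X × Y × B × L) = 2 ^ f * d)
    (hK' : dA * c ≤ Fintype.card (X × A × K')) (hL' : dB * d ≤ Fintype.card (Y × A × L'))
    (k₀' : K') (l₀' : L') :
    ∃ (E : Type) (_ : Fintype E) (_ : DecidableEq E), Fintype.card E = 2 ^ (f + g) ∧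
      Approx Uᴴ n g f ε (goal X Y B k₀ l₀)
        (spread fun (s : X × Y) (z : A × E) => ((s.1, (z, k₀')), (s.2, (z, l₀')))) := by
  obtain ⟨P, hP, hPε⟩ := h
  have hU' : Uᴴ ∈ Matrix.unitaryGroup (Fin dA × Fin dB) ℂ := Unitary.star_mem hU
  -- Blank ancillas of dimensions `dA` and `dB` give the registers the divisibility that
  -- `Reversible` demands.
  have iJ : IsIsometry (inj fun s : X × Y × B × K => ((⟨0, hdA⟩ : Fin dA), s)) :=
    isIsometry_inj fun s t h => (Prod.ext_iff.1 h).2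
  have iK : IsIsometry (inj fun s : X × Y × B × L => ((⟨0, hdB⟩ : Fin dB), s)) :=
    isIsometry_inj fun s t h => (Prod.ext_iff.1 h).2
  obtain ⟨R, S, E, _, _, _, _, _, _, J₁, J₂, hJ₁, hJ₂, hR, hS, hE, hr⟩ :=
    hP.reversible hU hdA hdB c d _ _ _ _ iJ iK
      (by rw [Fintype.card_prod, hc, Fintype.card_fin]; ring)
      (by rw [Fintype.card_prod, hd, Fintype.card_fin]; ring)
  obtain ⟨V, hV, hVJ⟩ := exists_isIsometry_mul_eq_inj hJ₁
    (e := fun s : X × A => (s.1, s.2, k₀')) (fun s t h => by simp_all [Prod.ext_iff])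
    (hR.trans_le hK')
  obtain ⟨W, hW, hWK⟩ := exists_isIsometry_mul_eq_inj hJ₂
    (e := fun s : Y × A => (s.1, s.2, l₀')) (fun s t h => by simp_all [Prod.ext_iff])
    (hS.trans_le hL')
  have h1 := (Reaches.localOps (U := Uᴴ) (J₁ ⊗ₖ J₂) hV hW).with_ctx (attach _ E)
  rw [← Matrix.mul_kronecker_mul, hVJ, hWK, inj_kronecker_inj] at h1
  obtain ⟨Q, hQ, hQP⟩ := hr.trans_local h1
  have hQ' := Protocol.comp' (.localOps _ _ iJ iK) hQ (zero_add _) (zero_add _) (zero_add _)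
  refine ⟨E, inferInstance, inferInstance, hE, Approx.trans_local (φ := ctx (inj (Prod.map
    (fun s : X × A => (s.1, s.2, k₀')) fun s : Y × A => (s.1, s.2, l₀')) * source X Y A)
    (attach (X × Y) E)) ⟨_, hQ', ?_⟩ ?_ hU'⟩
  · rw [← ctx_attach_mul, ← hQP, ← Matrix.mul_assoc Q, Matrix.mul_assoc (Q * _),
      ← Matrix.mul_sub]
    exact ((hQ'.isIsometry hU').opNorm_mul_le _).trans ((opNorm_sub_comm _ _).trans_le hPε)
  · have h : ∀ {X K : Type}, Function.Injective fun s : (X × A × K) × E =>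
        (s.1.1, ((s.1.2.1, s.2), s.1.2.2)) := by
      rintro X K ⟨⟨a, b, c⟩, d⟩ ⟨⟨a', b', c'⟩, d'⟩ h
      simp only [Prod.mk.injEq] at h ⊢
      tauto
    rw [source, inj_mul_spread, attach, ctx_spread, spread_congr_equiv _ (Equiv.prodComm A E)]
    exact Reaches.spread _ h h

end Transformations

/-! ### From coherent decoding to cobits in both directions. -/

section CoherentExchange

set_option synthInstance.maxSize 2000

variable {dA dB : ℕ} {U : Matrix (Fin dA × Fin dB) (Fin dA × Fin dB) ℂ} {n f g : ℕ} {ε : ℝ}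
  {X Y A B K L K' L' : Type}
  [Fintype X] [DecidableEq X] [Fintype Y] [DecidableEq Y] [Fintype A] [DecidableEq A]
  [Fintype B] [DecidableEq B] [Fintype K] [DecidableEq K] [Fintype L] [DecidableEq L]
  [Fintype K'] [DecidableEq K'] [Fintype L'] [DecidableEq L']

/-- Copying of the inputs `y` of Alice and `x` of Bob. -/
def copyInputs {X Y : Type} (s : Y × X) : (X × Y) × (Y × X) := ((s.2, s.1), s)

theorem injective_copyInputs {X Y : Type} : Function.Injective (copyInputs (X := X) (Y := Y)) :=
  fun _ _ h => (Prod.ext_iff.1 h).2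

/-- The ebits on `X × Y` hold every |x,y⟩|x,y⟩ with equal weight. Alice multiplies by the entry of
`G` for y and her message, Bob by the entry of `F` for x and his; the result is `goal` evaluated on
Fourier-transformed messages, while both parties keep their messages. -/
theorem reaches_ctx_goal {F : Matrix X X ℂ} {G : Matrix Y Y ℂ}
    (hF : ∀ i j, star (F i j) * F i j = 1) (hG : ∀ i j, star (G i j) * G i j = 1)
    (k₀ : K) (l₀ : L) :
    Reaches U 0 0 0 (source Y X (X × Y × B)) (ctx (goal X Y B k₀ l₀)
      ((((amp X • F) ⊗ₖ (amp Y • G)) ⊗ₖ (1 : Matrix (Y × X) (Y × X) ℂ)) *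
        (inj copyInputs : Matrix ((X × Y) × (Y × X)) (Y × X) ℂ))) := by
  have hi : ∀ {Y K : Type} (k₀ : K), Function.Injective
      fun s : Y × (X × Y × B) => ((s.2.1, s.2.2.1, s.2.2.2, k₀), s.1) := by
    rintro Y K k₀ ⟨a, b, c, d⟩ ⟨a', b', c', d'⟩ h
    simp only [Prod.mk.injEq] at h ⊢
    tauto
  have hj : ∀ {Y K : Type} (k₀ : K), Function.Injective
      fun s : X × (X × Y × B) => ((s.2.1, s.2.2.1, s.2.2.2, k₀), s.1) := by
    rintro Y K k₀ ⟨a, b, c, d⟩ ⟨a', b', c', d'⟩ h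
    simp only [Prod.mk.injEq] at h ⊢
    tauto
  have h₁ : Reaches U 0 0 0 (source Y X (X × Y × B)) _ := Reaches.spread _ (hi k₀) (hj l₀)
  have h₂ := h₁.trans_local (Reaches.localOps _
    (isIsometry_diagonal (d := fun r : (X × Y × B × K) × Y => G r.1.2.1 r.2) fun r => hG _ _)
    (isIsometry_diagonal (d := fun r : (X × Y × B × L) × X => F r.1.1 r.2) fun r => hF _ _))
  convert h₂ using 1
  ext ⟨⟨⟨x, y, b, k⟩, y'⟩, ⟨⟨x₁, y₁, b₁, l⟩, x'⟩⟩ ⟨s, t⟩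
  rw [diagonal_kronecker_diagonal_mul_apply, ctx_apply, mul_inj, spread_apply,
    Finset.sum_eq_single (x, y), Finset.sum_eq_single (x, y, b)]
  · simp only [goal_apply, Matrix.submatrix_apply, Matrix.kroneckerMap_apply, Matrix.smul_apply,
      Matrix.one_apply, copyInputs, id, smul_eq_mul, amp_prod, Prod.mk.injEq]
    rcases eq_or_ne y' s with rfl | h1
    · rcases eq_or_ne x' t with rfl | h2
      · by_cases h3 : x₁ = x ∧ y₁ = y ∧ b = b₁ ∧ k = k₀ ∧ l = l₀
        · obtain ⟨rfl, rfl, rfl, rfl, rfl⟩ := h3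
          simp
          ring
        · split_ifs <;> grind
      · simp [h2]
    · simp [h1]
  · rintro ⟨x₂, y₂, b₂⟩ - hne
    rw [if_neg]
    simp only [Prod.mk.injEq]
    rintro ⟨⟨⟨rfl, rfl, rfl, -⟩, -⟩, -⟩
    exact hne rfl
  · simp
  · rintro ⟨x₂, y₂⟩ - hne
    rw [goal_apply, if_neg, zero_mul]
    rintro ⟨rfl, rfl, -⟩
    exact hne rfl
  · simp

/-- After decoding, x is held by Alice alone and y by Bob alone, so each transform can be inverted
locally. -/
theorem reaches_mul_of_isIsometry {F : Matrix X X ℂ} {G : Matrix Y Y ℂ} (hF : IsIsometry F)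
    (hG : IsIsometry G) (k₀ : K) (l₀ : L) :
    Reaches U 0 0 0
      ((spread fun (s : X × Y) (z : A) => ((s.1, (z, k₀)), (s.2, (z, l₀)))) * (F ⊗ₖ G))
      (spread fun (s : X × Y) (z : A) => ((s.1, (z, k₀)), (s.2, (z, l₀)))) := by
  have h₁ : (spread fun (s : X × Y) (z : A) => ((s.1, (z, k₀)), (s.2, (z, l₀)))) =
      ctx 1 (spread fun (s : X × Y) (z : A) => (s, ((z, k₀), (z, l₀)))) := by
    rw [ctx_one]
  have hF' : IsIsometry Fᴴ := by
    rw [IsIsometry, Matrix.conjTranspose_conjTranspose]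
    exact mul_eq_one_comm.1 hF
  have hG' : IsIsometry Gᴴ := by
    rw [IsIsometry, Matrix.conjTranspose_conjTranspose]
    exact mul_eq_one_comm.1 hG
  rw [h₁, ctx_mul_right, ← kronecker_one_mul_spread, ← ctx_mul, Matrix.one_mul]
  have h₂ := (Reaches.localOps (U := U) (F ⊗ₖ G) hF' hG').with_ctx
    (spread fun (s : X × Y) (z : A) => (s, ((z, k₀), (z, l₀))))
  rw [← Matrix.mul_kronecker_mul, show Fᴴ * F = 1 from hF, show Gᴴ * G = 1 from hG,
    Matrix.one_kronecker_one] at h₂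
  exact h₂

theorem reaches_goal_of_ctx (k₀ : K) (l₀ : L) :
    Reaches U 0 0 0 (ctx (spread fun (s : X × Y) (z : A) => ((s.1, (z, k₀)), (s.2, (z, l₀))))
      (inj copyInputs)) (goal Y X A k₀ l₀) := by
  have hi : Function.Injective fun s : (X × (A × K)) × Y => (s.2, s.1.1, s.1.2.1, s.1.2.2) := by
    rintro ⟨⟨a, b, c⟩, d⟩ ⟨⟨a', b', c'⟩, d'⟩ h
    simp only [Prod.mk.injEq] at h ⊢
    tauto
  have hj : Function.Injective fun s : (Y × (A × L)) × X => (s.1.1, s.2, s.1.2.1, s.1.2.2) := by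
    rintro ⟨⟨a, b, c⟩, d⟩ ⟨⟨a', b', c'⟩, d'⟩ h
    simp only [Prod.mk.injEq] at h ⊢
    tauto
  rw [ctx_inj]
  exact Reaches.spread _ hi hj

theorem Approx.coherent_exchange (hU : U ∈ Matrix.unitaryGroup (Fin dA × Fin dB) ℂ) [Nonempty X]
    [Nonempty Y] {k₀ : K} {l₀ : L} {k₀' : K'} {l₀' : L'}
    (h : Approx U n f g ε (goal X Y B k₀ l₀)
      (spread fun (s : X × Y) (z : A) => ((s.1, (z, k₀')), (s.2, (z, l₀'))))) :
    Approx U n f g ε (source Y X (X × Y × B)) (goal Y X A k₀' l₀') := by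
  obtain ⟨F, hF, hFi⟩ := exists_hadamard X
  obtain ⟨G, hG, hGi⟩ := exists_hadamard Y
  have h₁ := (reaches_ctx_goal hF hG k₀ l₀).trans_approx (h.with_ctx
    (((hFi.kronecker hGi).kronecker isIsometry_one).mul (isIsometry_inj injective_copyInputs))) hU
  rw [← ctx_mul] at h₁
  exact (h₁.trans_local ((reaches_mul_of_isIsometry hFi hGi k₀' l₀').with_ctx _) hU).trans_local
    (reaches_goal_of_ctx k₀' l₀') hU

end CoherentExchange

/-! ### Reversal and chaining with explicit numbers of qubits. -/

section Bits

set_option synthInstance.maxSize 2000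

variable {dA dB : ℕ} {U : Matrix (Fin dA × Fin dB) (Fin dA × Fin dB) ℂ} {n f g : ℕ} {ε : ℝ}

/-- Rounding the gate dimensions up to 2 ^ c costs c extra blanks per party. All other blanks come
from the exact balance of qubits: for Alice, p + q + b + k - g are left after giving up the received
cobits, of which p + a hold her input and the old ebits. -/
theorem Approx.reverse_bits (hU : U ∈ Matrix.unitaryGroup (Fin dA × Fin dB) ℂ) (hn : n ≠ 0)
    {p q b a k l c : ℕ} (hA : dA ≤ 2 ^ c) (hB : dB ≤ 2 ^ c)
    (h : Approx U n f g ε (supply p q a) (target p q b k l)) :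
    g + a ≤ q + b + k ∧ f + a ≤ p + b + l ∧
      Approx Uᴴ n g f ε (supply q p (p + q + b))
        (target q p (a + (f + g)) (c + (q + b + k) - (g + a)) (c + (p + b + l) - (f + a))) := by
  have hU' : Uᴴ ∈ Matrix.unitaryGroup (Fin dA × Fin dB) ℂ := Unitary.star_mem hU
  obtain ⟨P, hP, hPε⟩ := id h
  have hd := hP.card_le
  obtain ⟨hdA, hdB⟩ := hP.dim_pos hn (by simp) (by simp)
  simp only [Nat.card_eq_fintype_card, Fintype.card_prod, Fintype.card_fun, Fintype.card_bool,
    Fintype.card_fin, ← pow_add] at hd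
  obtain ⟨h1, h2⟩ := hd
  -- These inequalities of exponents make the subtractions below genuine.
  rw [Nat.pow_le_pow_iff_right (by norm_num)] at h1 h2
  refine ⟨by omega, by omega, ?_⟩
  rw [supply_eq_spread, target_eq_spread] at h
  obtain ⟨E, _, _, hE, hr⟩ := Approx.reverse (A := Bits a) (K' := Bits (c + (q + b + k) - (g + a)))
    (L' := Bits (c + (p + b + l) - (f + a))) hU hdA hdB h
    (c := 2 ^ (p + q + b + k - g)) (d := 2 ^ (p + q + b + l - f))
    (by
      simp only [Fintype.card_prod, Fintype.card_fun, Fintype.card_bool, Fintype.card_fin,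
        ← pow_add]
      congr 1; omega)
    (by
      simp only [Fintype.card_prod, Fintype.card_fun, Fintype.card_bool, Fintype.card_fin,
        ← pow_add]
      congr 1; omega)
    (by
      refine (Nat.mul_le_mul_right _ hA).trans_eq ?_
      simp only [Fintype.card_prod, Fintype.card_fun, Fintype.card_bool, Fintype.card_fin,
        ← pow_add]
      congr 1; omega)
    (by
      refine (Nat.mul_le_mul_right _ hB).trans_eq ?_
      simp only [Fintype.card_prod, Fintype.card_fun, Fintype.card_bool, Fintype.card_fin,
        ← pow_add]
      congr 1; omega)
    (fun _ => false) (fun _ => false)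
  refine (Approx.coherent_exchange hU' hr).to_bits hU' (by simp) (by simp) ?_ ?_ (by simp)
    (by simp)
  · simp [pow_add, mul_assoc]
  · simp [hE, pow_add]

theorem Approx.sequential_bits (hU : U ∈ Matrix.unitaryGroup (Fin dA × Fin dB) ℂ)
    {n₂ f₂ g₂ : ℕ} {ε₂ : ℝ} {p q a b k l p₂ q₂ a₂ b₂ k₂ l₂ s : ℕ} (hs : b = a₂ + s)
    (h₁ : Approx U n f g ε (supply p q a) (target p q b k l))
    (h₂ : Approx U n₂ f₂ g₂ ε₂ (supply p₂ q₂ a₂) (target p₂ q₂ b₂ k₂ l₂)) :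
    Approx U (n + n₂) (f + f₂) (g + g₂) (ε + ε₂) (supply (p + p₂) (q + q₂) a)
      (target (p + p₂) (q + q₂) (s + b₂) (k + k₂) (l + l₂)) := by
  subst hs
  rw [supply_eq_spread, target_eq_spread] at h₁ h₂
  have h₃ := h₁.relabel (B' := Bits a₂ × Bits s) hU (Equiv.refl _) (Equiv.refl _) (Equiv.refl _)
    (Fintype.equivOfCardEq (by simp [pow_add])) Function.injective_id Function.injective_id
  refine (h₃.sequential hU h₂).to_bits hU ?_ ?_ ?_ ?_ ?_ ?_ <;> simp [pow_add]

theorem approx_zero (a : ℕ) : Approx U 0 0 0 0 (supply 0 0 a) (target 0 0 a 0 0) := by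
  rw [supply_eq_spread, target_eq_spread]
  refine Reaches.approx ?_
  have hi : Function.Injective fun s : Bits 0 × Bits a =>
      ((s.1, s.1, s.2, fun _ => false) : Bits 0 × Bits 0 × Bits a × Bits 0) := by
    rintro ⟨a, b⟩ ⟨a', b'⟩ h
    simp only [Prod.mk.injEq] at h ⊢
    tauto
  convert Reaches.spread _ hi hi using 1
  refine congrArg spread (funext₂ fun s z => ?_)
  obtain ⟨x, y⟩ := s
  obtain rfl : x = fun _ => false := Subsingleton.elim _ _
  obtain rfl : y = fun _ => false := Subsingleton.elim _ _
  rfl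

end Bits

/-! ### Rates, reuse of ebits, and the limit. -/

section Asymptotics

variable {dA dB : ℕ} {U : Matrix (Fin dA × Fin dB) (Fin dA × Fin dB) ℂ}
  {C₁ C₂ E η ε θ θ' : ℝ} {n m a u : ℕ}

/-- A clean protocol with error `θ` that starts from `a` ebits, of which no more than necessary
need to be consumed. -/
def CatalyticProtocolAt (U : Matrix (Fin dA × Fin dB) (Fin dA × Fin dB) ℂ)
    (C₁ C₂ E η θ : ℝ) (n a : ℕ) : Prop :=
  ∃ p q b f g k l : ℕ,
    Near η n p (max C₁ 0) ∧ Near η n q (max C₂ 0) ∧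
    Near η n f (max (-C₁) 0) ∧ Near η n g (max (-C₂) 0) ∧
    |(b : ℝ) - a - n * E| ≤ 6 * η * n ∧
    (k : ℝ) ≤ n * max (-E - C₂) 0 + 6 * η * n ∧
    (l : ℝ) ≤ n * max (-E - C₁) 0 + 6 * η * n ∧
    Approx U n f g θ (supply p q a) (target p q b k l)

theorem Near.add {N N' : ℕ} {r : ℝ} (h : Near η n N r) (h' : Near η m N' r) :
    Near η (n + m) (N + N') r := by
  unfold Near at *
  push_cast
  calc |(N : ℝ) + N' - (n + m) * r| = |(N - n * r) + (N' - m * r)| := by congr 1; ring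
    _ ≤ _ := abs_add_le _ _
    _ ≤ η * n + η * m := add_le_add h h'
    _ = _ := by ring

theorem Near.mono {N : ℕ} {r : ℝ} (h : Near η n N r) (hε : η ≤ ε) : Near ε n N r :=
  le_trans h (by gcongr)

theorem catalyticProtocolAt_zero (a : ℕ) : CatalyticProtocolAt U C₁ C₂ E η 0 0 a :=
  ⟨0, 0, a, 0, 0, 0, 0, by simp [Near], by simp [Near], by simp [Near], by simp [Near], by simp,
    by simp, by simp, approx_zero a⟩

/-- By `hu`, the first run certainly returns the `u` ebits that the second one starts from, whatever
the fluctuation 6ηn. -/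
theorem CatalyticProtocolAt.append (hU : U ∈ Matrix.unitaryGroup (Fin dA × Fin dB) ℂ)
    (h : CatalyticProtocolAt U C₁ C₂ E η θ n a) (h' : CatalyticProtocolAt U C₁ C₂ E η θ' m u)
    (hu : (u : ℝ) ≤ a + n * E - 6 * η * n) :
    CatalyticProtocolAt U C₁ C₂ E η (θ + θ') (n + m) a := by
  obtain ⟨p, q, b, f, g, k, l, hp, hq, hf, hg, hb, hk, hl, hP⟩ := h
  obtain ⟨p', q', b', f', g', k', l', hp', hq', hf', hg', hb', hk', hl', hP'⟩ := h'
  rw [abs_le] at hb hb'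
  obtain ⟨s, rfl⟩ : ∃ s, b = u + s := by
    refine Nat.exists_eq_add_of_le ?_
    have : (u : ℝ) ≤ b := by linarith
    exact_mod_cast this
  refine ⟨_, _, _, _, _, _, _, hp.add hp', hq.add hq', hf.add hf', hg.add hg', ?_, ?_, ?_,
    hP.sequential_bits hU rfl hP'⟩
  · rw [abs_le]
    push_cast at hb ⊢
    constructor <;> linarith
  · push_cast
    linarith
  · push_cast
    linarith

/-- The deviations of a (at most (ε - 6η)n) and of b - a (at most 6ηn) together stay within εn,
because E⁺ - E⁻ = E. -/
theorem CatalyticProtocolAt.cleanProtocolAt (h : CatalyticProtocolAt U C₁ C₂ E η θ n a)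
    (hη : 0 ≤ η) (hηε : 6 * η ≤ ε) (hθ : θ ≤ ε) (ha : Near (ε - 6 * η) n a (max (-E) 0)) :
    CleanProtocolAt U C₁ C₂ E ε n := by
  obtain ⟨p, q, b, f, g, k, l, hp, hq, hf, hg, hb, hk, hl, P, hP, hPθ⟩ := h
  have hE : max E 0 - max (-E) 0 = E := by
    rcases le_total E 0 with h | h <;> simp [h]
  have h6 : 6 * η * n ≤ ε * n := by gcongr
  have ha' := ha
  unfold Near at ha'
  rw [abs_le] at hb ha'
  have hnE : (n : ℝ) * max E 0 - n * max (-E) 0 = n * E := by rw [← mul_sub, hE]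
  refine ⟨p, q, b, f, g, a, k, l, hp.mono (by linarith), hq.mono (by linarith), ?_,
    hf.mono (by linarith), hg.mono (by linarith), ha.mono (by linarith), by linarith, by linarith,
    P, hP, hPθ.trans hθ⟩
  rw [Near, abs_le]
  constructor <;> linarith

/-- The 6η is a count of terms: the net number of ebits involves a, f, g, p, q, b, and Alice's
blanks involve c, q, b, k, g, a, each with an error of at most ηn. The identity x⁺ - x⁻ = x at x = E
+ C₂ and x = E + C₁ turns the old bounds on blanks into the new ones. -/
theorem CleanProtocolAt.reverse (hU : U ∈ Matrix.unitaryGroup (Fin dA × Fin dB) ℂ)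
    (h : CleanProtocolAt U C₁ C₂ E η n) (hn : n ≠ 0) {c : ℕ} (hA : dA ≤ 2 ^ c) (hB : dB ≤ 2 ^ c)
    (hc : (c : ℝ) ≤ η * n) :
    ∃ u : ℕ, (u : ℝ) ≤ n * (|C₁| + |C₂| + |E| + 3 * η) ∧
      CatalyticProtocolAt Uᴴ C₂ C₁ (-E - C₁ - C₂) η η n u := by
  obtain ⟨p, q, b, f, g, a, k, l, hp, hq, hb, hf, hg, ha, hk, hl, hP⟩ := h
  obtain ⟨h1, h2, hQ⟩ := Approx.reverse_bits hU hn hA hB hP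
  have hsub : ∀ x : ℝ, (n : ℝ) * max x 0 - n * max (-x) 0 = n * x := fun x => by
    rcases le_total x 0 with h | h <;> simp [h]
  have hle : ∀ x : ℝ, (n : ℝ) * max x 0 ≤ n * |x| := fun x => by
    gcongr
    exact max_le (le_abs_self x) (abs_nonneg x)
  have s1 := hsub C₁
  have s2 := hsub C₂
  have s3 := hsub E
  have sk := hsub (E + C₂)
  have sl := hsub (E + C₁)
  have t1 := hle C₁
  have t2 := hle C₂
  have t3 := hle E
  have np := abs_le.1 hp
  have nq := abs_le.1 hq
  have nb := abs_le.1 hb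
  have nf := abs_le.1 hf
  have ng := abs_le.1 hg
  have na := abs_le.1 ha
  rw [show -E - C₂ = -(E + C₂) by ring] at hk
  rw [show -E - C₁ = -(E + C₁) by ring] at hl
  refine ⟨p + q + b, ?_, _, _, _, _, _, _, _, hq, hp, hg, hf, ?_, ?_, ?_, hQ⟩
  · push_cast
    linarith
  · rw [abs_le]
    push_cast
    constructor <;> linarith
  · rw [Nat.cast_sub (by omega), show -(-E - C₁ - C₂) - C₁ = E + C₂ by ring]
    push_cast
    linarith
  · rw [Nat.cast_sub (by omega), show -(-E - C₁ - C₂) - C₂ = E + C₁ by ring]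
    push_cast
    linarith

/-- The initial stock covers the largest possible net consumption, the fluctuation and the start-up
cost `D` of a single block, so every block in turn can be fed. -/
theorem catalyticProtocolAt_of_blocks (hU : U ∈ Matrix.unitaryGroup (Fin dA × Fin dB) ℂ)
    {M : ℕ} (hM : 0 < M) {D : ℝ} (hη : 0 ≤ η)
    (h : ∀ m, n / M ≤ m → m ≤ n / M + 1 →
      ∃ u : ℕ, (u : ℝ) ≤ D ∧ CatalyticProtocolAt U C₁ C₂ E η η m u)
    (ha : D + 6 * η * n + n * max (-E) 0 ≤ a) :
    CatalyticProtocolAt U C₁ C₂ E η (M * η) n a := by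
  have key : ∀ j : ℕ, j ≤ M → CatalyticProtocolAt U C₁ C₂ E η (j * η) (n * j / M) a := by
    intro j
    induction j with
    | zero => intro _; simpa using catalyticProtocolAt_zero a
    | succ j ih =>
      intro hj
      -- Cutting at ⌊nj/M⌋ gives blocks whose lengths are ⌊n/M⌋ or ⌊n/M⌋ + 1.
      obtain ⟨m, hm, hm₁, hm₂⟩ :
          ∃ m, n * (j + 1) / M = n * j / M + m ∧ n / M ≤ m ∧ m ≤ n / M + 1 := by
        rw [mul_add, mul_one, Nat.add_div hM, add_assoc]
        exact ⟨_, rfl, by omega, by split_ifs <;> omega⟩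
      obtain ⟨u, hu, hr⟩ := h m hm₁ hm₂
      have hN : n * j / M ≤ n := Nat.div_le_of_le_mul (by
        rw [mul_comm]; exact Nat.mul_le_mul_right n (by omega))
      have hN' : ((n * j / M : ℕ) : ℝ) ≤ n := by exact_mod_cast hN
      have h1 : 6 * η * ((n * j / M : ℕ) : ℝ) ≤ 6 * η * n := by gcongr
      have h2 : ((n * j / M : ℕ) : ℝ) * -E ≤ n * max (-E) 0 :=
        (mul_le_mul_of_nonneg_left (le_max_left _ 0) (by positivity)).trans (by gcongr)
      rw [hm]
      push_cast
      rw [add_mul, one_mul]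
      exact (ih (by omega)).append hU hr (by linarith)
  simpa [Nat.mul_div_cancel _ hM] using key M le_rfl

theorem mem_clCCE_conjTranspose (hU : U ∈ Matrix.unitaryGroup (Fin dA × Fin dB) ℂ)
    (h : (C₁, C₂, E) ∈ clCCE U) : (C₂, C₁, -E - C₁ - C₂) ∈ clCCE Uᴴ := by
  have hU' : Uᴴ ∈ Matrix.unitaryGroup (Fin dA × Fin dB) ℂ := Unitary.star_mem hU
  intro ε hε
  set D : ℝ := |C₁| + |C₂| + |E| + 3 with hD
  have hD0 : 0 < D := by positivity
  -- A block has at most 2n/M uses and needs at most `D` ebits per use, so this `M` brings its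
  -- start-up cost down to εn/4.
  obtain ⟨M, hM⟩ := exists_nat_gt (8 * D / ε)
  have hM0 : (0 : ℝ) < M := lt_trans (by positivity) hM
  have hMN : 0 < M := by exact_mod_cast hM0
  -- The bound 1 gives 3η ≤ 3 in `D`, ε/24 gives 6η ≤ ε/4, and ε/M keeps the total error of the M
  -- blocks below ε.
  set η : ℝ := min 1 (min (ε / 24) (ε / M)) with hηd
  have hη : 0 < η := by positivity
  have hη1 : η ≤ 1 := min_le_left _ _
  have hη2 : η ≤ ε / 24 := (min_le_right _ _).trans (min_le_left _ _)
  have hη3 : η ≤ ε / M := (min_le_right _ _).trans (min_le_right _ _)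
  obtain ⟨c, hcA, hcB⟩ : ∃ c : ℕ, dA ≤ 2 ^ c ∧ dB ≤ 2 ^ c :=
    ⟨max dA dB, (le_max_left _ _).trans Nat.lt_two_pow_self.le,
      (le_max_right _ _).trans Nat.lt_two_pow_self.le⟩
  have hev := (h η hη).and ((eventually_ne_atTop 0).and
    ((tendsto_natCast_atTop_atTop (R := ℝ)).eventually_ge_atTop (c / η)))
  obtain ⟨N, hN⟩ := eventually_atTop.1 hev
  filter_upwards [eventually_ge_atTop (M * (N + 1)),
    (tendsto_natCast_atTop_atTop (R := ℝ)).eventually_ge_atTop (4 / ε)] with n hn hnε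
  have hnM : N + 1 ≤ n / M := (Nat.le_div_iff_mul_le hMN).2 (by rw [mul_comm]; exact hn)
  rw [div_le_iff₀ hε] at hnε
  have hblock : ∀ m, n / M ≤ m → m ≤ n / M + 1 → ∃ u : ℕ, (u : ℝ) ≤ ε / 4 * n ∧
      CatalyticProtocolAt Uᴴ C₂ C₁ (-E - C₁ - C₂) η η m u := by
    intro m hm₁ hm₂
    obtain ⟨hc, hm0, hcm⟩ := hN m (by omega)
    rw [div_le_iff₀' hη] at hcm
    obtain ⟨u, hu, hr⟩ := hc.reverse hU hm0 hcA hcB hcm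
    refine ⟨u, hu.trans ?_, hr⟩
    have h1 : (m : ℝ) * M ≤ 2 * n := by
      have : m * M ≤ 2 * n := by
        calc m * M ≤ (2 * (n / M)) * M := Nat.mul_le_mul_right _ (by omega)
          _ = 2 * (n / M * M) := by ring
          _ ≤ 2 * n := Nat.mul_le_mul_left _ (Nat.div_mul_le_self n M)
      exact_mod_cast this
    have h2 : 8 * D ≤ M * ε := by rw [div_lt_iff₀ hε] at hM; exact hM.le
    have h3 : (m : ℝ) * (|C₁| + |C₂| + |E| + 3 * η) ≤ m * D := by
      gcongr
      rw [hD]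
      linarith
    have h4 : (m : ℝ) * (8 * D) ≤ m * (M * ε) := by gcongr
    have h5 : (m : ℝ) * M * ε ≤ 2 * n * ε := by gcongr
    linarith
  set r : ℝ := max (-(-E - C₁ - C₂)) 0 with hr
  have hr0 : 0 ≤ r := le_max_right _ _
  -- Of the excess εn/2 over the net consumption, one half pays the start-up cost of a block and the
  -- other the fluctuation 6ηn. Rounding up adds less than 1 ≤ εn/4.
  set a : ℕ := ⌈(n : ℝ) * r + ε / 2 * n⌉₊ with ha
  have ha1 : (n : ℝ) * r + ε / 2 * n ≤ a := Nat.le_ceil _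
  have ha2 : (a : ℝ) < n * r + ε / 2 * n + 1 := Nat.ceil_lt_add_one (by positivity)
  have h6 : 6 * η * n ≤ ε / 4 * n := by gcongr; linarith
  refine (catalyticProtocolAt_of_blocks hU' hMN hη.le hblock (a := a)
    (by linarith)).cleanProtocolAt hη.le (by linarith) ?_ ?_
  · rwa [le_div_iff₀' hM0] at hη3
  · rw [Near, abs_le, sub_mul]
    constructor <;> linarith

end Asymptotics

end CleanGate

theorem mainTheorem1 {dA dB : ℕ} (U : Matrix (Fin dA × Fin dB) (Fin dA × Fin dB) ℂ)
    (hU : U ∈ Matrix.unitaryGroup (Fin dA × Fin dB) ℂ) (C₁ C₂ E : ℝ) :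
    (C₁, C₂, E) ∈ CleanGate.clCCE U ↔
      (C₂, C₁, -E - C₁ - C₂) ∈ CleanGate.clCCE Uᴴ := by
  -- The converse applies the same implication to the inverse gate, since -(-E - C₁ - C₂) - C₂ - C₁
  -- = E.
  refine ⟨CleanGate.mem_clCCE_conjTranspose hU, fun h => ?_⟩
  have h' := CleanGate.mem_clCCE_conjTranspose (Unitary.star_mem hU) h
  rw [Matrix.star_eq_conjTranspose, Matrix.conjTranspose_conjTranspose] at h'
  convert h' using 3
  ring
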